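/- Let $\mathbb{D}$ be the open unit disc, $\mathbb{T}$ the unit circle and $m$ the normalized Lebesgue measure on $\mathbb{T}$. For $0<p<\infty$, the Hardy space $H^p$ consists of the functions $f$ analytic in $\mathbb{D}$ with $\|f\|_p^p := \sup_{0<r<1}\int_{\mathbb{T}}|f(r\zeta)|^p\,dm(\zeta)<\infty$. Let $b$ be an element of the closed unit ball of $H^\infty$ (that is, $b$ is analytic in $\mathbb{D}$ and $|b|\le 1$) which is not an extreme point of this unit ball. Let $\mathcal{H}(b)$ be the de Branges–Rovnyak space, i.e. the Hilbert space of functions on $\mathbb{D}$ with reproducing kernel $$k_b(\lambda,z)=\frac{1-\overline{b(\lambda)}\,b(z)}{1-\overline{\lambda}z},\qquad \lambda,z\in\mathbb{D}.$$ Let $a$ be a Pythagorean mate of $b$: an outer function, i.e. $a(z)=c\exp\int_{\mathbb{T}}\frac{\zeta+z}{\zeta-z}u(\zeta)\,dm(\zeta)$ with $|c|=1$ and $u\in L^1(\mathbb{T})$ real-valued, which lies in the closed unit ball of $H^\infty$ and satisfies $|a|^2+|b|^2=1$ almost everywhere on $\mathbb{T}$ in the sense of radial limits, i.e. $\lim_{r\to1^-}\big(|a(r\zeta)|^2+|b(r\zeta)|^2\big)=1$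 for almost every $\zeta\in\mathbb{T}$. Put $\phi=b/a$. Let $p\in(2,\infty)$ and $\tilde p=\frac{2p}{p-2}$. Then: 1. $H^p\subset\mathcal{H}(b)$ if and only if $\phi\in H^{\tilde p}$. 2. The containment $H^p\subset\mathcal{H}(b)$ is never compact: it is not the case that $H^p\subset\mathcal{H}(b)$ and that the closed unit ball of $H^p$ is relatively compact in the norm of $\mathcal{H}(b)$. -/

import Mathlib

open scoped ComplexConjugate ComplexOrder Topology Complex.UnitDisc
open Set Filter MeasureTheory

noncomputable section

/-- Extension by zero to the whole plane of a function on the open unit disc. -/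
def discExt (f : 𝔻 → ℂ) (z : ℂ) : ℂ :=
  if h : ‖z‖ < 1 then f (Complex.UnitDisc.mk z h) else 0

/-- `f` is analytic (holomorphic) in the open unit disc. -/
def IsAnalyticOnDisc (f : 𝔻 → ℂ) : Prop :=
  DifferentiableOn ℂ (discExt f) (Metric.ball 0 1)

/-- The integral mean `∫_𝕋 |f(rζ)|^p dm(ζ)`, with `m` the normalized Lebesgue measure. -/
def hardyMean (p : ℝ) (f : 𝔻 → ℂ) (r : ℝ) : ℝ :=
  Real.circleAverage (fun z => ‖discExt f z‖ ^ p) 0 r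

/-- The Hardy space `H^p`, `0 < p < ∞`. -/
def hardySpace (p : ℝ) : Set (𝔻 → ℂ) :=
  {f | IsAnalyticOnDisc f ∧ BddAbove (hardyMean p f '' Ioo 0 1)}

/-- The norm `‖f‖_p = (sup_{0<r<1} ∫_𝕋 |f(rζ)|^p dm(ζ))^{1/p}` of `f ∈ H^p`. -/
def hardyNorm (p : ℝ) (f : 𝔻 → ℂ) : ℝ :=
  sSup (hardyMean p f '' Ioo 0 1) ^ (1 / p)

/-- The closed unit ball of `H^∞`, the algebra of bounded analytic functions in the disc. -/
def hInftyUnitBall : Set (𝔻 → ℂ) :=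
  {f | IsAnalyticOnDisc f ∧ ∀ z, ‖f z‖ ≤ 1}

/-- The de Branges–Rovnyak kernel, as a function of `z` the reproducing kernel at `w`:
`(1 - conj (b w) * b z) / (1 - conj w * z)`. -/
def dbrKernel (b : 𝔻 → ℂ) : Matrix 𝔻 𝔻 (ℂ →L[ℂ] ℂ) :=
  Matrix.of fun z w =>
    ((1 - conj (b w) * b z) / (1 - conj (w : ℂ) * (z : ℂ))) • (1 : ℂ →L[ℂ] ℂ)

theorem discExt_coe (f : 𝔻 → ℂ) (z : 𝔻) : discExt f z = f z := by
  simp [discExt, z.norm_lt_one]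

/-- The positivity of the kernel at radius `r < 1`. -/
theorem dbrKernel_aux (B : ℂ → ℂ) (hB : DifferentiableOn ℂ B (Metric.ball 0 1))
    (hB1 : ∀ z, ‖B z‖ ≤ 1) (s : Finset 𝔻) (v : 𝔻 → ℂ) (r : ℝ) (hr0 : 0 < r) (hr1 : r < 1)
    (hs : ∀ w ∈ s, ‖(w : ℂ)‖ < r) :
    0 ≤ (∑ w ∈ s, ∑ x ∈ s, conj (v w) * v x *
      ((1 - conj (B x) * B w) * (r ^ 2 / (r ^ 2 - conj (x : ℂ) * w)))).re := by
  set k : 𝔻 → ℂ → ℂ := fun x ζ => r ^ 2 / (r ^ 2 - conj (x : ℂ) * ζ) with hk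
  set U : ℂ → ℂ := fun ζ => ∑ x ∈ s, v x * k x ζ with hU
  set V : ℂ → ℂ := fun ζ => ∑ x ∈ s, v x * conj (B x) * k x ζ with hV
  have hne : ∀ x ∈ s, ∀ ζ : ℂ, ‖ζ‖ ≤ r → (r : ℂ) ^ 2 - conj (x : ℂ) * ζ ≠ 0 := by
    intro x hx ζ hζ h
    have h1 : ‖(r : ℂ) ^ 2‖ = ‖conj (x : ℂ) * ζ‖ := by rw [sub_eq_zero.1 h]
    rw [norm_mul, norm_pow, Complex.norm_real, RCLike.norm_conj, Real.norm_of_nonneg hr0.le] at h1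
    have := hs x hx
    nlinarith [norm_nonneg ζ, norm_nonneg (x : ℂ)]
  have hball : Metric.closedBall (0 : ℂ) r ⊆ Metric.ball 0 1 :=
    Metric.closedBall_subset_ball hr1
  have hkd : ∀ x ∈ s, DifferentiableOn ℂ (k x) (Metric.closedBall 0 r) := by
    intro x hx
    refine DifferentiableOn.div (by fun_prop) (by fun_prop) ?_
    intro ζ hζ
    exact hne x hx ζ (by simpa using hζ)
  have hUd : DifferentiableOn ℂ U (Metric.closedBall 0 r) :=
    DifferentiableOn.fun_sum fun x hx => (hkd x hx).const_mul _
  have hVd : DifferentiableOn ℂ V (Metric.closedBall 0 r) :=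
    DifferentiableOn.fun_sum fun x hx => (hkd x hx).const_mul _
  have hBd := hB.mono hball
  set F : 𝔻 → ℂ → ℂ := fun w ζ => B w * V ζ + U ζ - 2 * (B ζ * V ζ) with hF
  have hFd : ∀ w, DifferentiableOn ℂ (F w) (Metric.closedBall 0 r) := fun w =>
    ((hVd.const_mul _).add hUd).sub ((hBd.mul hVd).const_mul _)
  have hav : ∀ w ∈ s, Real.circleAverage (fun ζ => ((ζ - 0) / (ζ - w)) • F w ζ) 0 r = F w w := by
    intro w hw
    refine DiffContOnCl.circleAverage_smul_div ?_ ?_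
    · rw [abs_of_pos hr0]
      refine DifferentiableOn.diffContOnCl ?_
      rw [closure_ball _ hr0.ne']
      exact hFd w
    · rw [abs_of_pos hr0]; simpa using hs w hw
  have hint : ∀ w ∈ s, CircleIntegrable (fun ζ => conj (v w) • ((ζ - 0) / (ζ - w)) • F w ζ) 0 r := by
    intro w hw
    refine ContinuousOn.circleIntegrable hr0.le ?_
    have h1 : ContinuousOn (F w) (Metric.sphere 0 r) :=
      (hFd w).continuousOn.mono Metric.sphere_subset_closedBall
    have h0 : ContinuousOn (fun ζ : ℂ => (ζ - 0) / (ζ - w)) (Metric.sphere 0 r) := by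
      refine ContinuousOn.div (by fun_prop) (by fun_prop) ?_
      intro ζ hζ h
      have h2 : ‖ζ‖ = r := by simpa using hζ
      rw [sub_eq_zero.1 h] at h2
      exact (hs w hw).ne h2
    exact ContinuousOn.const_smul (c := conj (v w)) (h0.smul h1)
  set E : ℂ → ℂ := fun ζ => ∑ w ∈ s, conj (v w) • ((ζ - 0) / (ζ - w)) • F w ζ with hE
  have hEI : CircleIntegrable E 0 r := CircleIntegrable.fun_sum s hint
  have hEav : Real.circleAverage E 0 r = ∑ w ∈ s, ∑ x ∈ s, conj (v w) * v x *
      ((1 - conj (B x) * B w) * (r ^ 2 / (r ^ 2 - conj (x : ℂ) * w))) := by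
    rw [hE, Real.circleAverage_fun_sum hint]
    refine Finset.sum_congr rfl fun w hw => ?_
    rw [Real.circleAverage_fun_smul, hav w hw]
    simp only [hF, hU, hV, hk, smul_eq_mul, Finset.mul_sum, mul_add, mul_sub,
      ← Finset.sum_add_distrib, ← Finset.sum_sub_distrib]
    refine Finset.sum_congr rfl fun x hx => ?_
    ring
  rw [← hEav]
  have hre : (Real.circleAverage E 0 r).re = Real.circleAverage (fun ζ => (E ζ).re) 0 r :=
    (ContinuousLinearMap.circleAverage_comp_comm Complex.reCLM hEI).symm
  rw [hre]
  refine Real.circleAverage_nonneg_of_nonneg ?_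
  intro ζ hζ
  have hζr : ‖ζ‖ = r := by simpa [abs_of_pos hr0] using hζ
  have hkc : ∀ x ∈ s, conj (k x ζ) = ζ / (ζ - x) := by
    intro x hx
    have h0 : ζ ≠ 0 := by rw [← norm_pos_iff, hζr]; exact hr0
    have hrr : (r : ℂ) ^ 2 = ζ * conj ζ := by
      rw [Complex.mul_conj, Complex.normSq_eq_norm_sq, hζr]; push_cast; rfl
    have h3 : ζ - x ≠ 0 := by
      intro h
      rw [sub_eq_zero.1 h] at hζr
      exact (hs x hx).ne hζr
    have hc : conj ζ ≠ 0 := by simpa using h0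
    have h4 : conj (k x ζ) = (r : ℂ) ^ 2 / (r ^ 2 - x * conj ζ) := by
      simp [hk]
    rw [h4, hrr, ← sub_mul, mul_div_mul_right _ _ hc]
  have hEζ : E ζ = conj (V ζ) * V ζ + conj (U ζ) * U ζ - 2 * (B ζ * V ζ * conj (U ζ)) := by
    have e1 : conj (V ζ) = ∑ x ∈ s, conj (v x) * B x * (ζ / (ζ - x)) := by
      simp only [hV, map_sum, map_mul, Complex.conj_conj]
      exact Finset.sum_congr rfl fun x hx => by rw [hkc x hx]
    have e2 : conj (U ζ) = ∑ x ∈ s, conj (v x) * (ζ / (ζ - x)) := by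
      simp only [hU, map_sum, map_mul]
      exact Finset.sum_congr rfl fun x hx => by rw [hkc x hx]
    rw [e1, e2]
    simp only [hE, hF, smul_eq_mul, Finset.sum_mul, Finset.mul_sum, ← Finset.sum_add_distrib,
      ← Finset.sum_sub_distrib, sub_zero]
    refine Finset.sum_congr rfl fun x hx => ?_
    ring
  have hfin : (E ζ).re = ‖V ζ - conj (B ζ) * U ζ‖ ^ 2 + (1 - ‖B ζ‖ ^ 2) * ‖U ζ‖ ^ 2 := by
    rw [hEζ]
    simp only [← Complex.normSq_eq_norm_sq, Complex.normSq_apply, Complex.sub_re, Complex.add_re,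
      Complex.mul_re, Complex.mul_im, Complex.sub_im, Complex.conj_re, Complex.conj_im,
      Complex.re_ofNat, Complex.im_ofNat]
    ring
  show 0 ≤ (E ζ).re
  rw [hfin]
  have := hB1 ζ
  have h5 : 0 ≤ 1 - ‖B ζ‖ ^ 2 := by nlinarith [norm_nonneg (B ζ)]
  positivity

/-- The de Branges–Rovnyak kernel is positive semidefinite. -/
theorem dbrKernel_posSemidef {b : 𝔻 → ℂ} (hb : b ∈ hInftyUnitBall) :
    (dbrKernel b).PosSemidef := by
  have htfae := (RKHS.posSemidef_tfae (K := dbrKernel b)).out 0 2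
  refine htfae.mpr (And.intro ?_ fun vv => ?_)
  · ext z w
    simp [dbrKernel, Matrix.conjTranspose_apply, mul_comm]
  · have hB1 : ∀ z, ‖discExt b z‖ ≤ 1 := by
      intro z
      unfold discExt
      split_ifs with h
      · exact hb.2 _
      · simp
    have hev : ∀ᶠ r : ℝ in 𝓝[<] 1, 0 < r ∧ r < 1 ∧ ∀ w ∈ vv.support, ‖(w : ℂ)‖ < r := by
      have h1 : ∀ᶠ r : ℝ in 𝓝[<] 1, 0 < r :=
        (eventually_gt_nhds (by norm_num)).filter_mono nhdsWithin_le_nhds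
      have h2 : ∀ᶠ r : ℝ in 𝓝[<] 1, r < 1 := self_mem_nhdsWithin
      have h3 : ∀ᶠ r : ℝ in 𝓝[<] 1, ∀ w ∈ vv.support, ‖(w : ℂ)‖ < r :=
        (Filter.eventually_all_finset _).2 fun w _ =>
          (eventually_gt_nhds w.norm_lt_one).filter_mono nhdsWithin_le_nhds
      filter_upwards [h1, h2, h3] with r a b c using ⟨a, b, c⟩
    have hlim : Tendsto (fun r : ℝ => (∑ w ∈ vv.support, ∑ x ∈ vv.support, conj (vv w) * vv x *
        ((1 - conj (discExt b x) * discExt b w) *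
          ((r : ℂ) ^ 2 / ((r : ℂ) ^ 2 - conj (x : ℂ) * w)))).re) (𝓝[<] 1)
        (𝓝 (∑ w ∈ vv.support, ∑ x ∈ vv.support, conj (vv w) * vv x *
        ((1 - conj (discExt b x) * discExt b w) *
          (((1 : ℝ) : ℂ) ^ 2 / (((1 : ℝ) : ℂ) ^ 2 - conj (x : ℂ) * w)))).re) := by
      refine (Complex.continuous_re.tendsto _).comp ?_
      refine tendsto_finsetSum _ fun w _ => tendsto_finsetSum _ fun x _ => ?_
      refine Tendsto.const_mul _ (Tendsto.const_mul _ ?_)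
      have hc : Tendsto (fun r : ℝ => (r : ℂ) ^ 2) (𝓝[<] 1) (𝓝 (((1 : ℝ) : ℂ) ^ 2)) :=
        ((Complex.continuous_ofReal.pow 2).tendsto 1).mono_left nhdsWithin_le_nhds
      refine hc.div (hc.sub_const _) ?_
      intro h
      have h1 : ‖conj (x : ℂ) * w‖ = 1 := by rw [← sub_eq_zero.1 h]; simp
      rw [norm_mul, RCLike.norm_conj] at h1
      nlinarith [x.norm_lt_one, w.norm_lt_one, norm_nonneg (x : ℂ), norm_nonneg (w : ℂ)]
    have hpos := ge_of_tendsto hlim (hev.mono fun r hr =>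
      dbrKernel_aux (discExt b) hb.1 hB1 vv.support vv r hr.1 hr.2.1 hr.2.2)
    refine hpos.trans_eq ?_
    rw [Finset.sum_comm]
    simp only [Finsupp.sum]
    rw [← Complex.conj_re]
    simp only [map_sum, Complex.re_sum]
    refine Finset.sum_congr rfl fun x _ => Finset.sum_congr rfl fun w _ => ?_
    refine congrArg Complex.re ?_
    simp [dbrKernel, discExt_coe]
    ring

instance dbrKernel_fact (b : hInftyUnitBall) : Fact (dbrKernel (b : 𝔻 → ℂ)).PosSemidef :=
  ⟨dbrKernel_posSemidef b.2⟩

/-- The de Branges–Rovnyak space `H(b)`: the Hilbert space of functions on the disc with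
reproducing kernel `dbrKernel b`. -/
abbrev DeBrangesRovnyak (b : hInftyUnitBall) : Type :=
  RKHS.OfKernel (dbrKernel (b : 𝔻 → ℂ))

/-- The functions on the disc that belong to `H(b)`. -/
def dbrFunctions (b : hInftyUnitBall) : Set (𝔻 → ℂ) :=
  range fun F : DeBrangesRovnyak b => (F : 𝔻 → ℂ)

/-- `H^p` is compactly contained in `H(b)`: it is contained in `H(b)` and the closed unit ball
of `H^p` is relatively compact in the norm of `H(b)`. -/
def IsCompactlyContained (p : ℝ) (b : hInftyUnitBall) : Prop :=
  hardySpace p ⊆ dbrFunctions b ∧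
    IsCompact (closure {F : DeBrangesRovnyak b |
      (F : 𝔻 → ℂ) ∈ hardySpace p ∧ hardyNorm p F ≤ 1})

/-- Outer functions: `f(z) = c * exp (∫_𝕋 (ζ + z) / (ζ - z) * u(ζ) dm(ζ))` with `|c| = 1` and a
real-valued integrable `u` (the logarithm of the modulus of the boundary function). -/
def IsOuter (f : 𝔻 → ℂ) : Prop :=
  ∃ (c : ℂ) (u : ℂ → ℝ), ‖c‖ = 1 ∧ CircleIntegrable u 0 1 ∧
    ∀ z : 𝔻, f z =
      c * Complex.exp (Real.circleAverage (fun ζ => herglotzRieszKernel 0 z ζ * (u ζ : ℂ)) 0 1)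

/-- `a` is a Pythagorean mate of `b`: an outer function in the unit ball of `H^∞` with
`|a|² + |b|² = 1` almost everywhere on the unit circle, in the sense of radial limits.
(For bounded analytic `a`, `b` the radial limits of `a` and of `b` exist almost everywhere.) -/
def IsPythagoreanMate (a b : 𝔻 → ℂ) : Prop :=
  a ∈ hInftyUnitBall ∧ IsOuter a ∧
    ∀ᵐ θ : ℝ, Tendsto
      (fun r : ℝ => ‖discExt a (circleMap 0 r θ)‖ ^ 2 + ‖discExt b (circleMap 0 r θ)‖ ^ 2)
      (𝓝[<] 1) (𝓝 1)

end

/-! Write `φ = b/a`. Boundary functions are avoided: each inner product over the unit circle is a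
limit, as `r → 1`, of circle averages over `|z| = r`.

The central fact is a norm formula. A finite combination of reproducing kernels of `H(b)` has the
form `F = g - b v`, where `g = ∑ c_w k_w` and `v = ∑ c_w conj (b w) k_w` are combinations of Szegő
kernels. Since `|a|² + |b|² = 1` on the circle, `‖F‖²` in `H(b)` equals `‖F‖₂² + ‖a v‖₂²`
(`tendsto_circleNormSq_norm_kernelSum`). Hence `H(b)` sits contractively in `H²`, and the functional
`F ↦ ⟨F, b y⟩` has norm at most `‖a y‖₂` (`norm_le_of_tendsto_circlePairing`).

If `φ ∈ H^q` with `q = 2p/(p-2)`, then Hölder gives `f φ ∈ H²` for `f ∈ H^p`. Since `⟨f, g⟩ = ⟨f, F⟩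
+ ⟨f conj φ, a v⟩`, the norm formula and Cauchy–Schwarz show that `f` acts boundedly on kernel
combinations, so it lies in `H(b)` by Riesz (`mem_dbrFunctions_of_circleNormSq_le`).

Conversely, a containment `H^p ⊂ H(b)` is bounded by the closed graph theorem. Test the functional
bound on `y = g_n s`, where `a g_n` is bounded by `1` and tends to `1`, as is possible because `a`
is outer. In the limit `|⟨f, φ s⟩| ≤ C ‖f‖_p ‖s‖₂` (`exists_hasPairingBound`). The maximum principle
passes this to the dilations `φ(t ·)`. Multiplying `f` and `s` by high powers of `z` removes the
analyticity restriction on `s`, so `‖φ(t ·) f‖₂ ≤ C ‖f‖_p` on the circle. Choosing `f` nearly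
extremal in Hölder's inequality, with `|f|` close to `(1 + |φ(t ·)|²)^{1/(p-2)}`, bounds the means
of order `q` uniformly in `t`.

Compactness fails because the monomials lie in the unit ball of `H^p`, tend to `0` pointwise, and
have norm at least `1` in `H(b)`. -/

noncomputable section

/-! ### Circle averages -/

/-- The sesquilinear pairing `∫ f(rζ) conj (g(rζ)) dm(ζ)`. -/
def circlePairing (f g : ℂ → ℂ) (r : ℝ) : ℂ :=
  Real.circleAverage (fun z => f z * conj (g z)) 0 r

/-- The squared quadratic mean `∫ |f(rζ)|² dm(ζ)`. -/
def circleNormSq (f : ℂ → ℂ) (r : ℝ) : ℝ :=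
  Real.circleAverage (fun z => ‖f z‖ ^ 2) 0 r

theorem continuous_comp_circleMap {E : Type*} [TopologicalSpace E] {f : ℂ → E} {r : ℝ}
    (hr : 0 ≤ r) (hf : ContinuousOn f (Metric.sphere 0 r)) :
    Continuous fun θ => f (circleMap 0 r θ) :=
  hf.comp_continuous (continuous_circleMap 0 r) fun θ => circleMap_mem_sphere 0 hr θ

theorem norm_circleAverage_le {E : Type*} [NormedAddCommGroup E] [NormedSpace ℝ E] (f : ℂ → E)
    (r : ℝ) : ‖Real.circleAverage f 0 r‖ ≤ Real.circleAverage (fun z => ‖f z‖) 0 r := by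
  unfold Real.circleAverage
  rw [norm_smul, smul_eq_mul, Real.norm_of_nonneg (by positivity)]
  gcongr
  exact intervalIntegral.norm_integral_le_integral_norm Real.two_pi_pos.le

theorem circleAverage_mono_of_continuousOn {f g : ℂ → ℝ} {r : ℝ} (hr : 0 ≤ r)
    (hf : ContinuousOn f (Metric.sphere 0 r)) (hg : ContinuousOn g (Metric.sphere 0 r))
    (h : ∀ z, ‖z‖ = r → f z ≤ g z) :
    Real.circleAverage f 0 r ≤ Real.circleAverage g 0 r := by
  refine Real.circleAverage_mono (hf.circleIntegrable hr) (hg.circleIntegrable hr) fun z hz => ?_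
  exact h z (by simpa [abs_of_nonneg hr] using hz)

theorem circleAverage_congr_of_norm_eq {E : Type*} [NormedAddCommGroup E] [NormedSpace ℝ E]
    {f g : ℂ → E} {r : ℝ} (hr : 0 ≤ r) (h : ∀ z, ‖z‖ = r → f z = g z) :
    Real.circleAverage f 0 r = Real.circleAverage g 0 r :=
  Real.circleAverage_congr_sphere fun z hz => h z (by simpa [abs_of_nonneg hr] using hz)

/-- Hölder's inequality for circle averages. -/
theorem circleAverage_mul_le_Lp_mul_Lq {p q : ℝ} (hpq : p.HolderConjugate q) {f g : ℂ → ℝ} {r : ℝ}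
    (hr : 0 ≤ r) (hf : ContinuousOn f (Metric.sphere 0 r))
    (hg : ContinuousOn g (Metric.sphere 0 r)) (hf0 : ∀ z, 0 ≤ f z) (hg0 : ∀ z, 0 ≤ g z) :
    Real.circleAverage (fun z => f z * g z) 0 r ≤
      Real.circleAverage (fun z => f z ^ p) 0 r ^ (1 / p) *
        Real.circleAverage (fun z => g z ^ q) 0 r ^ (1 / q) := by
  have key : ∀ {h : ℂ → ℝ} {s : ℝ}, ContinuousOn h (Metric.sphere 0 r) →
      MemLp (fun θ => h (circleMap 0 r θ)) (ENNReal.ofReal s)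
        (volume.restrict (Ioc 0 (2 * Real.pi))) := by
    intro h s hh
    obtain ⟨M, hM⟩ := (isCompact_sphere (0 : ℂ) r).exists_bound_of_continuousOn hh
    exact MemLp.of_bound (continuous_comp_circleMap hr hh).aestronglyMeasurable M
      (Eventually.of_forall fun θ => hM _ (circleMap_mem_sphere 0 hr θ))
  have h1 := integral_mul_le_Lp_mul_Lq_of_nonneg hpq
    (μ := volume.restrict (Ioc 0 (2 * Real.pi)))
    (f := fun θ => f (circleMap 0 r θ)) (g := fun θ => g (circleMap 0 r θ))
    (Eventually.of_forall fun _ => hf0 _) (Eventually.of_forall fun _ => hg0 _) (key hf) (key hg)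
  unfold Real.circleAverage
  simp only [intervalIntegral.integral_of_le Real.two_pi_pos.le, smul_eq_mul]
  have hc : (0 : ℝ) ≤ (2 * Real.pi)⁻¹ := by positivity
  have hI : ∀ {h : ℂ → ℝ} {s : ℝ}, (∀ z, 0 ≤ h z) →
      0 ≤ ∫ θ in Ioc 0 (2 * Real.pi), h (circleMap 0 r θ) ^ s := fun hh =>
    integral_nonneg fun _ => Real.rpow_nonneg (hh _) _
  -- The normalizing factor `(2π)⁻¹` recombines because its two powers have exponents with sum `1`.
  rw [Real.mul_rpow hc (hI hf0), Real.mul_rpow hc (hI hg0), mul_mul_mul_comm,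
    ← Real.rpow_add' hc (by simp [hpq.inv_add_inv_eq_one])]
  simp only [one_div, hpq.inv_add_inv_eq_one, Real.rpow_one] at h1 ⊢
  gcongr

theorem circleNormSq_nonneg (f : ℂ → ℂ) (r : ℝ) : 0 ≤ circleNormSq f r :=
  Real.circleAverage_nonneg_of_nonneg fun _ _ => by positivity

theorem circlePairing_self (f : ℂ → ℂ) {r : ℝ} (hr : 0 ≤ r)
    (hf : ContinuousOn f (Metric.sphere 0 r)) :
    circlePairing f f r = (circleNormSq f r : ℂ) := by
  have h := ContinuousLinearMap.circleAverage_comp_comm Complex.ofRealCLM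
    (f := fun z => ‖f z‖ ^ 2) ((hf.norm.pow 2).circleIntegrable hr)
  have h2 : (Complex.ofRealCLM ∘ fun z => ‖f z‖ ^ 2) = fun z => f z * conj (f z) := by
    ext z
    simp [Complex.mul_conj, Complex.normSq_eq_norm_sq]
  rw [h2] at h
  exact h

theorem circlePairing_conj_symm (f g : ℂ → ℂ) (r : ℝ) (hr : 0 ≤ r)
    (hf : ContinuousOn f (Metric.sphere 0 r)) (hg : ContinuousOn g (Metric.sphere 0 r)) :
    circlePairing f g r = conj (circlePairing g f r) := by
  have h := ContinuousLinearMap.circleAverage_comp_comm (Complex.conjCLE : ℂ →L[ℝ] ℂ)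
    (f := fun z => g z * conj (f z))
    ((hg.mul (Complex.continuous_conj.comp_continuousOn hf)).circleIntegrable hr)
  have h2 : ((Complex.conjCLE : ℂ →L[ℝ] ℂ) ∘ fun z => g z * conj (f z)) =
      fun z => f z * conj (g z) := by
    ext z
    simp [mul_comm]
  rw [h2] at h
  simpa [circlePairing] using h

/-- The Cauchy–Schwarz inequality for circle averages. -/
theorem norm_circlePairing_le (f g : ℂ → ℂ) {r : ℝ} (hr : 0 ≤ r)
    (hf : ContinuousOn f (Metric.sphere 0 r)) (hg : ContinuousOn g (Metric.sphere 0 r)) :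
    ‖circlePairing f g r‖ ≤ √(circleNormSq f r) * √(circleNormSq g r) := by
  refine (norm_circleAverage_le _ _).trans ?_
  have h := circleAverage_mul_le_Lp_mul_Lq Real.HolderConjugate.two_two hr hf.norm hg.norm
    (fun _ => norm_nonneg _) (fun _ => norm_nonneg _)
  simpa [circleNormSq, Real.sqrt_eq_rpow] using h

theorem circlePairing_sub_left {f g h : ℂ → ℂ} {r : ℝ} (hr : 0 ≤ r)
    (hf : ContinuousOn f (Metric.sphere 0 r)) (hg : ContinuousOn g (Metric.sphere 0 r))
    (hh : ContinuousOn h (Metric.sphere 0 r)) :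
    circlePairing (fun z => f z - g z) h r = circlePairing f h r - circlePairing g h r := by
  have hc := Complex.continuous_conj.comp_continuousOn hh
  unfold circlePairing
  simp only [sub_mul]
  exact Real.circleAverage_fun_sub ((hf.mul hc).circleIntegrable hr)
    ((hg.mul hc).circleIntegrable hr)

theorem circlePairing_sub_right {f g h : ℂ → ℂ} {r : ℝ} (hr : 0 ≤ r)
    (hf : ContinuousOn f (Metric.sphere 0 r)) (hg : ContinuousOn g (Metric.sphere 0 r))
    (hh : ContinuousOn h (Metric.sphere 0 r)) :
    circlePairing h (fun z => f z - g z) r = circlePairing h f r - circlePairing h g r := by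
  have hc := Complex.continuous_conj.comp_continuousOn hf
  have hc' := Complex.continuous_conj.comp_continuousOn hg
  unfold circlePairing
  simp only [mul_sub, map_sub]
  exact Real.circleAverage_fun_sub ((hh.mul hc).circleIntegrable hr)
    ((hh.mul hc').circleIntegrable hr)

theorem circleNormSq_le_of_norm_le {f : ℂ → ℂ} {r M : ℝ} (hr : 0 ≤ r)
    (hf : ContinuousOn f (Metric.sphere 0 r)) (h : ∀ z, ‖z‖ = r → ‖f z‖ ≤ M) :
    circleNormSq f r ≤ M ^ 2 := by
  refine Real.circleAverage_mono_on_of_le_circle ((hf.norm.pow 2).circleIntegrable hr) ?_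
  intro z hz
  have := h z (by simpa [abs_of_nonneg hr] using hz)
  gcongr

theorem circleNormSq_mono {f g : ℂ → ℂ} {r : ℝ} (hr : 0 ≤ r)
    (hf : ContinuousOn f (Metric.sphere 0 r)) (hg : ContinuousOn g (Metric.sphere 0 r))
    (h : ∀ z, ‖z‖ = r → ‖f z‖ ≤ ‖g z‖) : circleNormSq f r ≤ circleNormSq g r :=
  circleAverage_mono_of_continuousOn hr (hf.norm.pow 2) (hg.norm.pow 2) fun z hz => by
    have := h z hz
    gcongr

/-- Dominated convergence for circle averages as the radius tends to `1`. -/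
theorem tendsto_circleAverage_nhdsLT_one {E : Type*} [NormedAddCommGroup E] [NormedSpace ℝ E]
    {F : ℂ → E} {M : ℝ}
    (hF : ContinuousOn F (Metric.ball 0 1)) (hM : ∀ z, ‖z‖ < 1 → ‖F z‖ ≤ M)
    (h : ∀ᵐ θ : ℝ, Tendsto (fun r : ℝ => F (circleMap 0 r θ)) (𝓝[<] 1) (𝓝 0)) :
    Tendsto (fun r => Real.circleAverage F 0 r) (𝓝[<] 1) (𝓝 0) := by
  have hev : ∀ᶠ r : ℝ in 𝓝[<] 1, 0 < r ∧ r < 1 := by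
    filter_upwards [self_mem_nhdsWithin, (eventually_gt_nhds (zero_lt_one (α := ℝ))).filter_mono
      nhdsWithin_le_nhds] with r h1 h2 using ⟨h2, h1⟩
  have hI : Tendsto (fun r : ℝ => ∫ θ in (0 : ℝ)..2 * Real.pi, F (circleMap 0 r θ)) (𝓝[<] 1)
      (𝓝 (∫ _ in (0 : ℝ)..2 * Real.pi, (0 : E))) := by
    refine intervalIntegral.tendsto_integral_filter_of_dominated_convergence (fun _ => M) ?_ ?_
      (by simp) ?_
    · filter_upwards [hev] with r hr
      refine (continuous_comp_circleMap hr.1.le (hF.mono ?_)).aestronglyMeasurable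
      intro z hz
      simpa [mem_sphere_zero_iff_norm.1 hz] using hr.2
    · filter_upwards [hev] with r hr
      refine Eventually.of_forall fun θ _ => hM _ ?_
      simpa [abs_of_pos hr.1] using hr.2
    · filter_upwards [h] with θ hθ _ using hθ
  simpa [Real.circleAverage] using hI.const_smul (2 * Real.pi)⁻¹

/-- Bounded convergence for circle averages on a fixed circle. -/
theorem tendsto_circleAverage_of_bounded {E ι : Type*} [NormedAddCommGroup E] [NormedSpace ℝ E]
    {l : Filter ι} [l.IsCountablyGenerated] {F : ι → ℂ → E} {G : ℂ → E} {M r : ℝ} (hr : 0 ≤ r)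
    (hF : ∀ᶠ n in l, ContinuousOn (F n) (Metric.sphere 0 r))
    (hM : ∀ᶠ n in l, ∀ z, ‖z‖ = r → ‖F n z‖ ≤ M)
    (h : ∀ z, ‖z‖ = r → Tendsto (fun n => F n z) l (𝓝 (G z))) :
    Tendsto (fun n => Real.circleAverage (F n) 0 r) l (𝓝 (Real.circleAverage G 0 r)) := by
  refine Tendsto.const_smul ?_ _
  have hn : ∀ θ : ℝ, ‖circleMap 0 r θ‖ = r := fun θ => by simp [abs_of_nonneg hr]
  refine intervalIntegral.tendsto_integral_filter_of_dominated_convergence (fun _ => M) ?_ ?_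
      (by simp) ?_
  · filter_upwards [hF] with n hn using (continuous_comp_circleMap hr hn).aestronglyMeasurable
  · filter_upwards [hM] with n h'
    exact Eventually.of_forall fun θ _ => h' _ (hn θ)
  · exact Eventually.of_forall fun θ _ => h _ (hn θ)

theorem circleAverage_comp_mul_left {E : Type*} [NormedAddCommGroup E] [NormedSpace ℝ E]
    (F : ℂ → E) (η : ℂ) (hη : ‖η‖ = 1) (r : ℝ) :
    Real.circleAverage (fun z => F (η * z)) 0 r = Real.circleAverage F 0 r := by
  obtain ⟨t, rfl⟩ := (Complex.norm_eq_one_iff η).1 hη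
  rw [Real.circleAverage_eq_integral_add (f := F) t, Real.circleAverage]
  congr 2
  ext θ
  congr 1
  simp only [circleMap, zero_add]
  push_cast
  rw [add_mul, Complex.exp_add]
  ring

theorem circleAverage_comp_mul_real {E : Type*} [NormedAddCommGroup E] [NormedSpace ℝ E]
    (F : ℂ → E) (t r : ℝ) :
    Real.circleAverage (fun z => F (t * z)) 0 r = Real.circleAverage F 0 (t * r) := by
  unfold Real.circleAverage
  congr 2
  ext θ
  simp [circleMap, mul_assoc]

/-! ### Changing the radius in a pairing; monotone quadratic means -/

/-- Cauchy's theorem for circle averages over two circles bounding an annulus. -/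
theorem circleAverage_eq_of_differentiableAt_annulus {F : ℂ → ℂ} {r R : ℝ} (hr : 0 < r)
    (hrR : r ≤ R) (hF : ∀ z, r ≤ ‖z‖ → ‖z‖ ≤ R → DifferentiableAt ℂ F z) :
    Real.circleAverage F 0 R = Real.circleAverage F 0 r := by
  rw [Real.circleAverage_eq_circleIntegral (hr.trans_le hrR).ne',
    Real.circleAverage_eq_circleIntegral hr.ne']
  congr 1
  refine Complex.circleIntegral_sub_center_inv_smul_eq_of_differentiable_on_annulus_off_countable
    hr hrR countable_empty ?_ ?_
  · intro z hz
    refine (hF z ?_ ?_).continuousAt.continuousWithinAt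
    · simpa using hz.2
    · simpa using hz.1
  · intro z hz
    refine hF z ?_ ?_
    · exact le_of_lt (by simpa using hz.1.2)
    · exact le_of_lt (by simpa using hz.1.1)

/-- The pairing `∫ f(sζ) conj (y(tζ)) dm` depends only on the product `s t`. -/
theorem circlePairing_eq_circlePairing_comp_mul {f y : ℂ → ℂ} {r R S : ℝ} (hr : 0 < r)
    (hrR : r ≤ R) (hRS : R < S) (hf : DifferentiableOn ℂ f (Metric.ball 0 S))
    (hy : DifferentiableOn ℂ y (Metric.ball 0 S)) :
    circlePairing f y r = circlePairing (fun z => f (((r / R) ^ 2 : ℝ) * z)) y R := by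
  have hR : 0 < R := hr.trans_le hrR
  have hf' : ∀ z, ‖z‖ < S → DifferentiableAt ℂ f z := fun z hz =>
    hf.differentiableAt (Metric.isOpen_ball.mem_nhds (by simpa using hz))
  have hy' : ∀ z, ‖z‖ < S → DifferentiableAt ℂ y z := fun z hz =>
    hy.differentiableAt (Metric.isOpen_ball.mem_nhds (by simpa using hz))
  have hmem : ∀ {t : ℝ}, 0 < t → t < S → ∀ z ∈ Metric.sphere (0 : ℂ) t, ‖z‖ < S := by
    intro t _ htS z hz
    rwa [mem_sphere_zero_iff_norm.1 hz]
  have hq : (r / R) ^ 2 ≤ 1 := pow_le_one₀ (by positivity) ((div_le_one hR).2 hrR)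
  have hq0 : 0 ≤ (r / R) ^ 2 := by positivity
  have hqz : ∀ z : ℂ, ‖z‖ < S → ‖(((r / R) ^ 2 : ℝ) : ℂ) * z‖ < S := by
    intro z hz
    rw [norm_mul, Complex.norm_real, Real.norm_of_nonneg hq0]
    nlinarith [norm_nonneg z]
  have hfc : ∀ t, 0 < t → t < S → ContinuousOn f (Metric.sphere 0 t) := fun t h0 h1 z hz =>
    (hf' z (hmem h0 h1 z hz)).continuousAt.continuousWithinAt
  have hyc : ∀ t, 0 < t → t < S → ContinuousOn y (Metric.sphere 0 t) := fun t h0 h1 z hz =>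
    (hy' z (hmem h0 h1 z hz)).continuousAt.continuousWithinAt
  have hfq : ContinuousOn (fun z => f (((r / R) ^ 2 : ℝ) * z)) (Metric.sphere 0 R) := by
    intro z hz
    have h1 := hf' _ (hqz z (hmem hR hRS z hz))
    exact (h1.continuousAt.comp (f := fun z => (((r / R) ^ 2 : ℝ) : ℂ) * z)
      (by fun_prop)).continuousWithinAt
  rw [circlePairing_conj_symm f y r hr.le (hfc r hr (hrR.trans_lt hRS)) (hyc r hr (hrR.trans_lt hRS)),
    circlePairing_conj_symm _ y R hR.le hfq (hyc R hR hRS)]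
  congr 1
  -- Reflection in the circle `|z| = r` makes `y conj f` analytic in the annulus. The reflected
  -- point `conj (r²/z)` is `z` itself on the inner circle and `(r/R)² z` on the outer one.
  set F : ℂ → ℂ := fun z => y z * conj (f (conj ((r : ℂ) ^ 2 / z))) with hFdef
  have hann : Real.circleAverage F 0 R = Real.circleAverage F 0 r := by
    refine circleAverage_eq_of_differentiableAt_annulus hr hrR fun z h1 h2 => ?_
    have hz : z ≠ 0 := norm_pos_iff.1 (hr.trans_le h1)
    refine (hy' z (h2.trans_lt hRS)).mul ?_
    have h3 : ‖(r : ℂ) ^ 2 / z‖ < S := by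
      rw [norm_div, norm_pow, Complex.norm_real, Real.norm_of_nonneg hr.le,
        div_lt_iff₀ (hr.trans_le h1)]
      nlinarith
    have h4 : DifferentiableAt ℂ (conj ∘ f ∘ conj) ((r : ℂ) ^ 2 / z) :=
      differentiableAt_conj_conj_iff.2 (hf' _ (by rwa [RCLike.norm_conj]))
    exact h4.comp z (f := fun z => (r : ℂ) ^ 2 / z) (by fun_prop (disch := assumption))
  unfold circlePairing
  rw [← circleAverage_congr_of_norm_eq (f := F) hr.le, ← hann]
  · refine circleAverage_congr_of_norm_eq hR.le fun z hz => ?_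
    have hz0 : z ≠ 0 := norm_pos_iff.1 (hz ▸ hR)
    have hzz : z * conj z = (R : ℂ) ^ 2 := by
      rw [Complex.mul_conj, Complex.normSq_eq_norm_sq, hz]; push_cast; rfl
    have hc : conj ((r : ℂ) ^ 2 / z) = ((r / R) ^ 2 : ℝ) * z := by
      have hc0 : conj z ≠ 0 := by simpa using hz0
      have hRc : (R : ℂ) ≠ 0 := by exact_mod_cast hR.ne'
      simp only [map_div₀, map_pow, Complex.conj_ofReal]
      push_cast
      rw [div_pow, ← hzz]
      field_simp
    simp only [hFdef, hc]
  · intro z hz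
    have hz0 : z ≠ 0 := norm_pos_iff.1 (hz ▸ hr)
    have hzz : z * conj z = (r : ℂ) ^ 2 := by
      rw [Complex.mul_conj, Complex.normSq_eq_norm_sq, hz]; push_cast; rfl
    simp only [hFdef, ← hzz, mul_div_cancel_left₀ _ hz0, Complex.conj_conj]

theorem DifferentiableOn.continuousOn_sphere {f : ℂ → ℂ} {r S : ℝ}
    (hf : DifferentiableOn ℂ f (Metric.ball 0 S)) (hr : r < S) :
    ContinuousOn f (Metric.sphere 0 r) :=
  hf.continuousOn.mono fun z hz => by simpa [mem_sphere_zero_iff_norm.1 hz] using hr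

/-- The quadratic mean of an analytic function increases with the radius. -/
theorem circleNormSq_le_circleNormSq {f : ℂ → ℂ} {r R S : ℝ} (hr : 0 < r) (hrR : r ≤ R)
    (hRS : R < S) (hf : DifferentiableOn ℂ f (Metric.ball 0 S)) :
    circleNormSq f r ≤ circleNormSq f R := by
  have hR : 0 < R := hr.trans_le hrR
  have hcont : ∀ t ≤ R, ContinuousOn f (Metric.sphere 0 t) := fun t ht =>
    hf.continuousOn_sphere (ht.trans_lt hRS)
  obtain ⟨M, hM⟩ := (isCompact_closedBall (0 : ℂ) R).exists_bound_of_continuousOn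
    (hf.continuousOn.mono (Metric.closedBall_subset_ball hRS))
  have hbdd : BddAbove (circleNormSq f '' Ioc 0 R) := by
    refine ⟨M ^ 2, ?_⟩
    rintro _ ⟨t, ht, rfl⟩
    exact circleNormSq_le_of_norm_le ht.1.le (hcont t ht.2) fun z hz =>
      hM z (by simpa [hz] using ht.2)
  set s := sSup (circleNormSq f '' Ioc 0 R) with hs
  have hle : ∀ t ∈ Ioc 0 R, circleNormSq f t ≤ s := fun t ht =>
    le_csSup hbdd (mem_image_of_mem _ ht)
  have hs0 : 0 ≤ s := (circleNormSq_nonneg f R).trans (hle R ⟨hR, le_rfl⟩)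
  -- The mean at `t` is the pairing on `|z| = R` of `f((t/R)² ·)` with `f`, and the mean of the
  -- first factor is again one of those bounded by `s`. Taking the supremum over `t` gives `s ≤ √s
  -- √(mean at R)`, hence `s ≤` the mean at `R`.
  have hstep : ∀ t ∈ Ioc 0 R, circleNormSq f t ≤ √s * √(circleNormSq f R) := by
    intro t ht
    have hq : (t / R) ^ 2 ≤ 1 := pow_le_one₀ (by have := ht.1; positivity) ((div_le_one hR).2 ht.2)
    have hq0 : 0 < (t / R) ^ 2 := by have := ht.1; positivity
    have h1 := circlePairing_eq_circlePairing_comp_mul ht.1 ht.2 hRS hf hf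
    rw [circlePairing_self f ht.1.le (hcont t ht.2)] at h1
    have hc : ContinuousOn (fun z => f (((t / R) ^ 2 : ℝ) * z)) (Metric.sphere 0 R) := by
      refine hf.continuousOn.comp (by fun_prop) fun z hz => ?_
      rw [mem_ball_zero_iff, norm_mul, mem_sphere_zero_iff_norm.1 hz, Complex.norm_real,
        Real.norm_of_nonneg hq0.le]
      nlinarith
    have h2 := norm_circlePairing_le _ f hR.le hc (hcont R le_rfl)
    rw [← h1, Complex.norm_real, Real.norm_of_nonneg (circleNormSq_nonneg _ _)] at h2
    refine h2.trans ?_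
    gcongr
    have h3 : circleNormSq (fun z => f (((t / R) ^ 2 : ℝ) * z)) R =
        circleNormSq f ((t / R) ^ 2 * R) :=
      circleAverage_comp_mul_real (fun z => ‖f z‖ ^ 2) _ _
    rw [h3]
    exact hle _ ⟨by positivity, by nlinarith⟩
  have hfin : s ≤ √s * √(circleNormSq f R) := by
    refine csSup_le ⟨_, mem_image_of_mem _ ⟨hR, le_rfl⟩⟩ ?_
    rintro _ ⟨t, ht, rfl⟩
    exact hstep t ht
  refine (hle r ⟨hr, hrR⟩).trans ?_
  rcases hs0.eq_or_lt with h | h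
  · rw [← h]; exact circleNormSq_nonneg _ _
  · have h4 : √s ≤ √(circleNormSq f R) := by
      refine le_of_mul_le_mul_left ?_ (Real.sqrt_pos.2 h)
      rwa [Real.mul_self_sqrt hs0]
    exact (Real.sqrt_le_sqrt_iff (circleNormSq_nonneg _ _)).1 h4

/-! ### The Szegő kernel -/

/-- The Szegő kernel. -/
def szegoKernel (w z : ℂ) : ℂ := 1 / (1 - conj w * z)

theorem one_sub_conj_mul_ne_zero {w z : ℂ} (hw : ‖w‖ < 1) (hz : ‖z‖ < 1) : 1 - conj w * z ≠ 0 := by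
  intro h
  have h1 : ‖conj w * z‖ = 1 := by rw [← sub_eq_zero.1 h]; simp
  rw [norm_mul, RCLike.norm_conj] at h1
  nlinarith [norm_nonneg w, norm_nonneg z]

theorem differentiableOn_szegoKernel {w : ℂ} (hw : ‖w‖ < 1) :
    DifferentiableOn ℂ (szegoKernel w) (Metric.ball 0 1) :=
  DifferentiableOn.div (by fun_prop) (by fun_prop) fun _ hz =>
    one_sub_conj_mul_ne_zero hw (by simpa using hz)

theorem norm_szegoKernel_le {w z : ℂ} (hw : ‖w‖ < 1) (hz : ‖z‖ < 1) :
    ‖szegoKernel w z‖ ≤ 1 / (1 - ‖w‖) := by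
  unfold szegoKernel
  rw [norm_div, norm_one]
  have h1 : 1 - ‖w‖ ≤ ‖1 - conj w * z‖ := by
    have := norm_sub_norm_le (1 : ℂ) (conj w * z)
    rw [norm_one, norm_mul, RCLike.norm_conj] at this
    nlinarith [norm_nonneg w]
  have : 0 < 1 - ‖w‖ := by linarith
  gcongr

/-- On `|z| = r` the conjugate of the Szegő kernel is `z / (z - r² w)`, so this is Cauchy's formula
at `r² w`. The reproducing property at `w` itself appears only as `r → 1`. -/
theorem circlePairing_szegoKernel {y : ℂ → ℂ} {w : ℂ} {r : ℝ} (hr : 0 < r) (hr1 : r < 1)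
    (hw : ‖w‖ < 1) (hy : DifferentiableOn ℂ y (Metric.ball 0 1)) :
    circlePairing y (szegoKernel w) r = y (r ^ 2 * w) := by
  have hmem : ‖(r : ℂ) ^ 2 * w‖ < r := by
    rw [norm_mul, norm_pow, Complex.norm_real, Real.norm_of_nonneg hr.le]
    nlinarith [norm_nonneg w, mul_pos hr hr]
  have h := DiffContOnCl.circleAverage_smul_div (R := r) (c := 0) (f := y) (w := (r : ℂ) ^ 2 * w)
    (by
      rw [abs_of_pos hr]
      refine DifferentiableOn.diffContOnCl ?_
      rw [closure_ball _ hr.ne']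
      exact hy.mono (Metric.closedBall_subset_ball hr1))
    (by rw [abs_of_pos hr]; simpa using hmem)
  rw [← h]
  refine circleAverage_congr_of_norm_eq hr.le fun z hz => ?_
  have hz0 : z ≠ 0 := norm_pos_iff.1 (hz ▸ hr)
  have hzz : z * conj z = (r : ℂ) ^ 2 := by
    rw [Complex.mul_conj, Complex.normSq_eq_norm_sq, hz]; push_cast; rfl
  have h1 : 1 - w * conj z ≠ 0 := by
    intro h'
    have : 1 - conj w * z = 0 := by simpa using congrArg conj h'
    exact one_sub_conj_mul_ne_zero hw (by rw [hz]; exact hr1) this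
  have h2 : z - (r : ℂ) ^ 2 * w = z * (1 - w * conj z) := by rw [← hzz]; ring
  rw [sub_zero, h2, szegoKernel]
  simp only [map_div₀, map_one, map_sub, map_mul, Complex.conj_conj, smul_eq_mul]
  field_simp

/-! ### Herglotz integrals and cyclicity of outer functions -/

section Outer

theorem continuousOn_herglotzRieszKernel {z : ℂ} (hz : ‖z‖ < 1) :
    ContinuousOn (herglotzRieszKernel 0 z) (Metric.sphere 0 1) := by
  unfold herglotzRieszKernel
  refine ContinuousOn.div (by fun_prop) (by fun_prop) fun ζ hζ h => ?_
  have h1 : ζ = z := by simpa [sub_eq_zero] using h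
  rw [mem_sphere_zero_iff_norm, h1] at hζ
  exact hz.ne hζ

theorem circleIntegrable_herglotzRieszKernel_mul {u : ℂ → ℝ} (hu : CircleIntegrable u 0 1) {z : ℂ}
    (hz : ‖z‖ < 1) :
    CircleIntegrable (fun ζ => herglotzRieszKernel 0 z ζ * (u ζ : ℂ)) 0 1 := by
  have h1 : CircleIntegrable (fun ζ => (u ζ : ℂ)) 0 1 := by
    simp only [CircleIntegrable, intervalIntegrable_iff] at hu ⊢
    exact Complex.ofRealCLM.integrable_comp hu
  exact IntervalIntegrable.continuousOn_mul h1
    (continuous_comp_circleMap zero_le_one (continuousOn_herglotzRieszKernel hz)).continuousOn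

theorem re_herglotzRieszKernel_nonneg {z ζ : ℂ} (hz : ‖z‖ < 1) (hζ : ζ ∈ Metric.sphere (0 : ℂ) |1|) :
    0 ≤ (herglotzRieszKernel 0 z ζ).re := by
  have h := congrFun (poissonKernel_eq_re_herglotzRieszKernel (c := 0) (w := z)) ζ
  rw [Function.comp_apply] at h
  rw [← h, poissonKernel]
  have hζ' : ‖ζ‖ = 1 := by simpa using hζ
  rw [sub_zero, sub_zero, hζ']
  have : ‖z‖ ^ 2 ≤ 1 := pow_le_one₀ (norm_nonneg _) hz.le
  have h2 : 0 ≤ (1 : ℝ) ^ 2 - ‖z‖ ^ 2 := by linarith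
  positivity

/-- The Herglotz integral of a real function on the unit circle. -/
def herglotzIntegral (u : ℂ → ℝ) (z : ℂ) : ℂ :=
  Real.circleAverage (fun ζ => herglotzRieszKernel 0 z ζ * (u ζ : ℂ)) 0 1

theorem differentiableOn_herglotzIntegral {u : ℂ → ℝ} (hu : CircleIntegrable u 0 1) :
    DifferentiableOn ℂ (herglotzIntegral u) (Metric.ball 0 1) := by
  refine differentiableOn_circleAverage_herglotzRieszKernel_smul (f := fun ζ => (u ζ : ℂ)) ?_
  simp only [CircleIntegrable, intervalIntegrable_iff] at hu ⊢
  exact Complex.ofRealCLM.integrable_comp hu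

theorem herglotzIntegral_sub {u v : ℂ → ℝ} (hu : CircleIntegrable u 0 1)
    (hv : CircleIntegrable v 0 1) {z : ℂ} (hz : ‖z‖ < 1) :
    herglotzIntegral (fun ζ => u ζ - v ζ) z = herglotzIntegral u z - herglotzIntegral v z := by
  unfold herglotzIntegral
  rw [← Real.circleAverage_fun_sub (circleIntegrable_herglotzRieszKernel_mul hu hz)
    (circleIntegrable_herglotzRieszKernel_mul hv hz)]
  simp only [Complex.ofReal_sub, mul_sub]

/-- The real part of the Herglotz kernel is the Poisson kernel, which is nonnegative. This turns
inequalities between boundary data into bounds for the moduli of the exponentials. -/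
theorem re_herglotzIntegral_nonneg {u : ℂ → ℝ} (hu : CircleIntegrable u 0 1) (h0 : ∀ ζ, 0 ≤ u ζ)
    {z : ℂ} (hz : ‖z‖ < 1) : 0 ≤ (herglotzIntegral u z).re := by
  have h := re_circleAverage_herglotzRieszKernel_smul (R := 1) hu (w := z) (by simpa using hz)
  simp only [smul_eq_mul] at h
  rw [herglotzIntegral, h]
  exact Real.circleAverage_nonneg_of_nonneg fun ζ hζ =>
    mul_nonneg (re_herglotzRieszKernel_nonneg hz hζ) (h0 ζ)

theorem herglotzIntegral_const (t : ℝ) {z : ℂ} (hz : ‖z‖ < 1) :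
    (herglotzIntegral (fun _ => t) z).re = t := by
  have h := re_circleAverage_herglotzRieszKernel_smul (R := 1) (g := fun _ => t)
    (circleIntegrable_const t 0 1) (w := z) (by simpa using hz)
  simp only [smul_eq_mul] at h
  rw [herglotzIntegral, h]
  exact InnerProductSpace.HarmonicOnNhd.circleAverage_re_herglotzRieszKernel_smul
    (fun x _ => InnerProductSpace.harmonicAt_const t) (by simpa using hz)

theorem CircleIntegrable.max_const {u : ℂ → ℝ} (hu : CircleIntegrable u 0 1) (t : ℝ) :
    CircleIntegrable (fun ζ => max (u ζ) t) 0 1 := by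
  have h := circleIntegrable_const t 0 1
  simp only [CircleIntegrable, intervalIntegrable_iff] at hu h ⊢
  exact hu.sup h

/-- An outer function is cyclic: there are bounded analytic `g n` such that the products `f * g n`
are bounded by `1` and converge to `1` in the disc. -/
theorem IsOuter.exists_tendsto_mul_one {f : 𝔻 → ℂ} (hf : IsOuter f) :
    ∃ g : ℕ → ℂ → ℂ, (∀ n, DifferentiableOn ℂ (g n) (Metric.ball 0 1)) ∧
      (∀ n, ∃ M, ∀ z, ‖z‖ < 1 → ‖g n z‖ ≤ M) ∧
      (∀ n z, ‖z‖ < 1 → ‖discExt f z * g n z‖ ≤ 1) ∧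
      ∀ z, ‖z‖ < 1 → Tendsto (fun n => discExt f z * g n z) atTop (𝓝 1) := by
  obtain ⟨c, u, hc, hu, hfu⟩ := hf
  -- Truncating `log |f|` from below at `-n` and inverting gives `g n`: `v n ≥ -n` yields `|g n| ≤
  -- e^n`, `v n ≥ u` yields `|f * g n| ≤ 1`, and `v n - u → 0`, dominated by `|u|`, yields
  -- convergence to `1`.
  set v : ℕ → ℂ → ℝ := fun n ζ => max (u ζ) (-n) with hv
  have hvi : ∀ n, CircleIntegrable (v n) 0 1 := fun n => hu.max_const _
  have hcc : c * conj c = 1 := by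
    rw [Complex.mul_conj, Complex.normSq_eq_norm_sq, hc]; simp
  have hfg : ∀ n z, ‖z‖ < 1 → discExt f z * (conj c * Complex.exp (-herglotzIntegral (v n) z)) =
      Complex.exp (-herglotzIntegral (fun ζ => v n ζ - u ζ) z) := by
    intro n z hz
    rw [herglotzIntegral_sub (hvi n) hu hz, neg_sub, sub_eq_add_neg, Complex.exp_add]
    have h1 : discExt f z = c * Complex.exp (herglotzIntegral u z) := by
      rw [discExt, dif_pos hz, hfu]
      rfl
    rw [h1]
    linear_combination (Complex.exp (herglotzIntegral u z) *
      Complex.exp (-herglotzIntegral (v n) z)) * hcc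
  have hdi : ∀ n, CircleIntegrable (fun ζ => v n ζ - u ζ) 0 1 := fun n => (hvi n).sub hu
  refine ⟨fun n z => conj c * Complex.exp (-herglotzIntegral (v n) z), fun n => ?_, fun n => ?_,
    fun n z hz => ?_, fun z hz => ?_⟩
  · exact ((differentiableOn_herglotzIntegral (hvi n)).neg.cexp).const_mul _
  · refine ⟨Real.exp n, fun z hz => ?_⟩
    rw [norm_mul, RCLike.norm_conj, hc, one_mul, Complex.norm_exp, Complex.neg_re]
    gcongr
    have h1 := re_herglotzIntegral_nonneg (u := fun ζ => v n ζ - (-n))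
      ((hvi n).sub (circleIntegrable_const _ _ _)) (fun ζ => sub_nonneg.2 (le_max_right _ _)) hz
    rw [herglotzIntegral_sub (hvi n) (circleIntegrable_const _ _ _) hz, Complex.sub_re,
      herglotzIntegral_const _ hz] at h1
    linarith
  · rw [hfg n z hz, Complex.norm_exp, Complex.neg_re]
    have h1 := re_herglotzIntegral_nonneg (hdi n) (fun ζ => by simp [hv]) hz
    exact Real.exp_le_one_iff.2 (by linarith)
  · simp only [hfg _ z hz]
    have h0 : Tendsto (fun n => herglotzIntegral (fun ζ => v n ζ - u ζ) z) atTop (𝓝 0) := by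
      have hi := circleIntegrable_herglotzRieszKernel_mul hu hz
      have h1 : Tendsto (fun n : ℕ => ∫ θ in (0 : ℝ)..2 * Real.pi,
          herglotzRieszKernel 0 z (circleMap 0 1 θ) *
            ((v n (circleMap 0 1 θ) - u (circleMap 0 1 θ) : ℝ) : ℂ)) atTop
          (𝓝 (∫ _ in (0 : ℝ)..2 * Real.pi, (0 : ℂ))) := by
        refine intervalIntegral.tendsto_integral_filter_of_dominated_convergence
          (fun θ => ‖herglotzRieszKernel 0 z (circleMap 0 1 θ) * (u (circleMap 0 1 θ) : ℂ)‖)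
          ?_ ?_ (IntervalIntegrable.norm hi) ?_
        · refine Eventually.of_forall fun n => ?_
          have := circleIntegrable_herglotzRieszKernel_mul (hdi n) hz
          rw [CircleIntegrable, intervalIntegrable_iff] at this
          exact this.aestronglyMeasurable
        · refine Eventually.of_forall fun n => Eventually.of_forall fun θ _ => ?_
          rw [norm_mul, norm_mul]
          gcongr
          rw [Complex.norm_real, Complex.norm_real, Real.norm_eq_abs, Real.norm_eq_abs]
          have hn : (0 : ℝ) ≤ n := n.cast_nonneg
          simp only [hv]
          rcases max_cases (u (circleMap 0 1 θ)) (-(n : ℝ)) with h | h <;> rw [h.1]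
          · simp
          · rw [abs_of_nonneg (by linarith), abs_of_nonpos (by linarith)]
            linarith
        · refine Eventually.of_forall fun θ _ => ?_
          refine tendsto_const_nhds.congr' ?_
          obtain ⟨N, hN⟩ := exists_nat_ge (-u (circleMap 0 1 θ))
          filter_upwards [eventually_ge_atTop N] with n hn
          have : -(n : ℝ) ≤ u (circleMap 0 1 θ) := by
            have : (N : ℝ) ≤ n := by exact_mod_cast hn
            linarith
          simp [hv, max_eq_left this]
      have h2 := h1.const_smul (2 * Real.pi)⁻¹
      simpa [herglotzIntegral, Real.circleAverage] using h2
    simpa [Function.comp_def] using (Complex.continuous_exp.tendsto _).comp h0.neg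

end Outer

theorem eventually_mem_Ioo_nhdsLT_one : ∀ᶠ r : ℝ in 𝓝[<] 1, 0 < r ∧ r < 1 := by
  filter_upwards [self_mem_nhdsWithin, (eventually_gt_nhds (zero_lt_one (α := ℝ))).filter_mono
    nhdsWithin_le_nhds] with r h1 h2 using ⟨h2, h1⟩

/-! ### Combinations of Szegő kernels -/

/-- Finite linear combinations of Szegő kernels. -/
def szegoSum (s : Finset 𝔻) (c : 𝔻 → ℂ) (z : ℂ) : ℂ := ∑ w ∈ s, c w * szegoKernel w z

theorem differentiableOn_szegoSum (s : Finset 𝔻) (c : 𝔻 → ℂ) :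
    DifferentiableOn ℂ (szegoSum s c) (Metric.ball 0 1) :=
  DifferentiableOn.fun_sum fun w _ => (differentiableOn_szegoKernel w.norm_lt_one).const_mul _

theorem exists_norm_szegoSum_le (s : Finset 𝔻) (c : 𝔻 → ℂ) :
    ∃ M, ∀ z, ‖z‖ < 1 → ‖szegoSum s c z‖ ≤ M := by
  refine ⟨∑ w ∈ s, ‖c w‖ * (1 / (1 - ‖(w : ℂ)‖)), fun z hz => norm_sum_le_of_le _ fun w _ => ?_⟩
  rw [norm_mul]
  gcongr
  exact norm_szegoKernel_le w.norm_lt_one hz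

theorem circlePairing_szegoSum {y : ℂ → ℂ} {r : ℝ} (hr : 0 < r) (hr1 : r < 1)
    (hy : DifferentiableOn ℂ y (Metric.ball 0 1)) (s : Finset 𝔻) (c : 𝔻 → ℂ) :
    circlePairing y (szegoSum s c) r = ∑ w ∈ s, conj (c w) * y (r ^ 2 * w) := by
  have h1 : (fun z => y z * conj (szegoSum s c z)) =
      fun z => ∑ w ∈ s, conj (c w) • (y z * conj (szegoKernel w z)) := by
    ext z
    simp only [szegoSum, map_sum, map_mul, Finset.mul_sum, smul_eq_mul]
    exact Finset.sum_congr rfl fun w _ => by ring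
  rw [circlePairing, h1, Real.circleAverage_fun_sum]
  · refine Finset.sum_congr rfl fun w _ => ?_
    rw [Real.circleAverage_fun_smul, smul_eq_mul]
    congr 1
    exact circlePairing_szegoKernel hr hr1 w.norm_lt_one hy
  · intro w _
    refine ContinuousOn.circleIntegrable hr.le ?_
    exact ContinuousOn.const_smul (c := conj (c w)) ((hy.continuousOn_sphere hr1).mul
      (Complex.continuous_conj.comp_continuousOn
        ((differentiableOn_szegoKernel w.norm_lt_one).continuousOn_sphere hr1)))

theorem tendsto_circlePairing_szegoSum {y : ℂ → ℂ} (hy : DifferentiableOn ℂ y (Metric.ball 0 1))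
    (s : Finset 𝔻) (c : 𝔻 → ℂ) :
    Tendsto (fun r => circlePairing y (szegoSum s c) r) (𝓝[<] 1)
      (𝓝 (∑ w ∈ s, conj (c w) * y w)) := by
  have h : Tendsto (fun r : ℝ => ∑ w ∈ s, conj (c w) * y ((r : ℂ) ^ 2 * w)) (𝓝[<] 1)
      (𝓝 (∑ w ∈ s, conj (c w) * y w)) := by
    refine tendsto_finsetSum _ fun w _ => Tendsto.const_mul _ ?_
    have h1 : Tendsto (fun r : ℝ => (r : ℂ) ^ 2 * w) (𝓝[<] 1) (𝓝 (w : ℂ)) := by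
      have : Continuous fun r : ℝ => (r : ℂ) ^ 2 * w := by fun_prop
      simpa using (this.tendsto 1).mono_left nhdsWithin_le_nhds
    have h2 : ContinuousAt y w := (hy.differentiableAt
      (Metric.isOpen_ball.mem_nhds (by simpa using w.norm_lt_one))).continuousAt
    exact h2.tendsto.comp h1
  refine h.congr' ?_
  filter_upwards [eventually_mem_Ioo_nhdsLT_one] with r hr
  exact (circlePairing_szegoSum hr.1 hr.2 hy s c).symm

theorem tendsto_circlePairing_szegoSum_left {y : ℂ → ℂ}
    (hy : DifferentiableOn ℂ y (Metric.ball 0 1)) (s : Finset 𝔻) (c : 𝔻 → ℂ) :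
    Tendsto (fun r => circlePairing (szegoSum s c) y r) (𝓝[<] 1)
      (𝓝 (conj (∑ w ∈ s, conj (c w) * y w))) := by
  refine ((Complex.continuous_conj.tendsto _).comp
    (tendsto_circlePairing_szegoSum hy s c)).congr' ?_
  filter_upwards [eventually_mem_Ioo_nhdsLT_one] with r hr
  exact (circlePairing_conj_symm _ _ r hr.1.le
    ((differentiableOn_szegoSum s c).continuousOn_sphere hr.2) (hy.continuousOn_sphere hr.2)).symm

/-! ### Pythagorean pairs and the norm identity -/

/-- A pair of analytic functions in the unit ball of `H^∞` with `|A|² + |B|² = 1` a.e. on the unit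
circle, in the sense of radial limits. -/
structure IsPythagoreanPair (A B : ℂ → ℂ) : Prop where
  left : DifferentiableOn ℂ A (Metric.ball 0 1)
  right : DifferentiableOn ℂ B (Metric.ball 0 1)
  norm_left_le : ∀ z, ‖A z‖ ≤ 1
  norm_right_le : ∀ z, ‖B z‖ ≤ 1
  radial : ∀ᵐ θ : ℝ, Tendsto
      (fun r : ℝ => ‖A (circleMap 0 r θ)‖ ^ 2 + ‖B (circleMap 0 r θ)‖ ^ 2) (𝓝[<] 1) (𝓝 1)

namespace IsPythagoreanPair

variable {A B : ℂ → ℂ}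

/-- The expression is the average of `(|A|² + |B|² - 1) x conj y`, which is bounded and tends to `0`
along almost every radius. This is the point where the boundary identity enters. -/
theorem tendsto_circlePairing (h : IsPythagoreanPair A B) {x y : ℂ → ℂ} {M N : ℝ}
    (hx : DifferentiableOn ℂ x (Metric.ball 0 1)) (hy : DifferentiableOn ℂ y (Metric.ball 0 1))
    (hxM : ∀ z, ‖z‖ < 1 → ‖x z‖ ≤ M) (hyN : ∀ z, ‖z‖ < 1 → ‖y z‖ ≤ N) :
    Tendsto (fun r => circlePairing (fun z => B z * x z) (fun z => B z * y z) r +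
      circlePairing (fun z => A z * x z) (fun z => A z * y z) r - circlePairing x y r)
      (𝓝[<] 1) (𝓝 0) := by
  set F : ℂ → ℂ := fun z => ((‖A z‖ ^ 2 + ‖B z‖ ^ 2 - 1 : ℝ) : ℂ) * (x z * conj (y z)) with hF
  have hA := h.left.continuousOn
  have hB := h.right.continuousOn
  have hFc : ContinuousOn F (Metric.ball 0 1) := by
    refine (Complex.continuous_ofReal.comp_continuousOn
      (((hA.norm.pow 2).add (hB.norm.pow 2)).sub continuousOn_const)).mul
      (hx.continuousOn.mul (Complex.continuous_conj.comp_continuousOn hy.continuousOn))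
  have hb : ∀ z, ‖z‖ < 1 → ‖x z * conj (y z)‖ ≤ M * N := by
    intro z hz
    rw [norm_mul, RCLike.norm_conj]
    exact mul_le_mul (hxM z hz) (hyN z hz) (norm_nonneg _) ((norm_nonneg _).trans (hxM z hz))
  have hb1 : ∀ z, |‖A z‖ ^ 2 + ‖B z‖ ^ 2 - 1| ≤ 1 := by
    intro z
    have h1 : ‖A z‖ ^ 2 ≤ 1 := pow_le_one₀ (norm_nonneg _) (h.norm_left_le z)
    have h2 : ‖B z‖ ^ 2 ≤ 1 := pow_le_one₀ (norm_nonneg _) (h.norm_right_le z)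
    have h3 := sq_nonneg ‖A z‖
    have h4 := sq_nonneg ‖B z‖
    rw [abs_le]
    constructor <;> linarith
  have key : Tendsto (fun r => Real.circleAverage F 0 r) (𝓝[<] 1) (𝓝 0) := by
    refine tendsto_circleAverage_nhdsLT_one (M := 1 * (M * N)) hFc (fun z hz => ?_) ?_
    · rw [norm_mul, Complex.norm_real]
      exact mul_le_mul (hb1 z) (hb z hz) (norm_nonneg _) zero_le_one
    · filter_upwards [h.radial] with θ hθ
      have h1 : Tendsto (fun r : ℝ => ((‖A (circleMap 0 r θ)‖ ^ 2 + ‖B (circleMap 0 r θ)‖ ^ 2 - 1 : ℝ)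
          : ℂ)) (𝓝[<] 1) (𝓝 0) := by
        have := (Complex.continuous_ofReal.tendsto _).comp (hθ.sub_const 1)
        simpa [Function.comp_def] using this
      refine h1.zero_mul_isBoundedUnder_le ⟨M * N, ?_⟩
      rw [eventually_map]
      filter_upwards [eventually_mem_Ioo_nhdsLT_one] with r hr
      exact hb _ (by simpa [abs_of_pos hr.1] using hr.2)
  refine key.congr' ?_
  filter_upwards [eventually_mem_Ioo_nhdsLT_one] with r hr
  have hc : ∀ {f g : ℂ → ℂ}, ContinuousOn f (Metric.ball 0 1) → ContinuousOn g (Metric.ball 0 1) →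
      CircleIntegrable (fun z => f z * conj (g z)) 0 r := by
    intro f g hf hg
    refine ContinuousOn.circleIntegrable hr.1.le ?_
    refine (hf.mul (Complex.continuous_conj.comp_continuousOn hg)).mono fun z hz => ?_
    simpa [mem_sphere_zero_iff_norm.1 hz] using hr.2
  have i1 := hc (f := fun z => B z * x z) (g := fun z => B z * y z) (hB.mul hx.continuousOn)
    (hB.mul hy.continuousOn)
  have i2 := hc (f := fun z => A z * x z) (g := fun z => A z * y z) (hA.mul hx.continuousOn)
    (hA.mul hy.continuousOn)
  have i3 := hc hx.continuousOn hy.continuousOn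
  unfold circlePairing
  rw [← Real.circleAverage_fun_add i1 i2]
  refine Eq.trans ?_ (Real.circleAverage_fun_sub (i1.add i2) i3)
  congr 1
  ext z
  simp only [hF, Complex.ofReal_sub, Complex.ofReal_add, Complex.ofReal_one,
    ← Complex.normSq_eq_norm_sq, ← Complex.mul_conj, map_mul]
  ring

variable (s : Finset 𝔻) (c : 𝔻 → ℂ)

/-- The element `g - B v` of `H(B)`, with `g` the combination of Szegő kernels with coefficients
`c` and `v` that with coefficients `c · conj B`. -/
def kernelFun (B : ℂ → ℂ) (s : Finset 𝔻) (c : 𝔻 → ℂ) (z : ℂ) : ℂ :=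
  szegoSum s c z - B z * szegoSum s (fun w => c w * conj (B w)) z

theorem differentiableOn_kernelFun (h : IsPythagoreanPair A B) :
    DifferentiableOn ℂ (kernelFun B s c) (Metric.ball 0 1) :=
  (differentiableOn_szegoSum _ _).sub (h.right.mul (differentiableOn_szegoSum _ _))

/-- With `kernelFun = g - B v`, replace `⟨B v, B y⟩` by `⟨v, y⟩ - ⟨A v, A y⟩`. The remaining `⟨g, B
y⟩ - ⟨v, y⟩` tends to `0` because the coefficients of `v` carry exactly the factors `conj (B w)`
that reproduction of `B y` produces. -/
theorem tendsto_circlePairing_kernelFun_mul (h : IsPythagoreanPair A B) {y : ℂ → ℂ} {N : ℝ}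
    (hy : DifferentiableOn ℂ y (Metric.ball 0 1)) (hyN : ∀ z, ‖z‖ < 1 → ‖y z‖ ≤ N) :
    Tendsto (fun r => circlePairing (kernelFun B s c) (fun z => B z * y z) r -
      circlePairing (fun z => A z * szegoSum s (fun w => c w * conj (B w)) z)
        (fun z => A z * y z) r) (𝓝[<] 1) (𝓝 0) := by
  set v := szegoSum s (fun w => c w * conj (B w)) with hv
  have hvd : DifferentiableOn ℂ v (Metric.ball 0 1) := differentiableOn_szegoSum _ _
  obtain ⟨M, hM⟩ := exists_norm_szegoSum_le s (fun w => c w * conj (B w))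
  have h0 := h.tendsto_circlePairing hvd hy hM hyN
  have h1 := tendsto_circlePairing_szegoSum_left (h.right.mul hy) s c
  have h2 := tendsto_circlePairing_szegoSum_left hy s (fun w => c w * conj (B w))
  have h3 := (h1.sub h2).sub h0
  have h4 : ∑ w ∈ s, conj (c w * conj (B w)) * y w = ∑ w ∈ s, conj (c w) * (B w * y w) :=
    Finset.sum_congr rfl fun w _ => by simp [mul_assoc]
  simp only [Pi.mul_def, h4, sub_self] at h3
  refine h3.congr' ?_
  filter_upwards [eventually_mem_Ioo_nhdsLT_one] with r hr
  have e1 : circlePairing (kernelFun B s c) (fun z => B z * y z) r = _ :=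
    circlePairing_sub_left hr.1.le ((differentiableOn_szegoSum s c).continuousOn_sphere hr.2)
      ((h.right.mul hvd).continuousOn_sphere hr.2) ((h.right.mul hy).continuousOn_sphere hr.2)
  rw [e1]
  ring

/-- For `F = g - B v`, expand `⟨F, F⟩ = ⟨F, g⟩ - ⟨g, B v⟩ + ⟨B v, B v⟩` and replace the last term by
`⟨v, v⟩ - ⟨A v, A v⟩`. The terms `⟨g, B v⟩` and `⟨v, v⟩` have the same limit, and `⟨F, g⟩`
reproduces the values of `F`. -/
theorem tendsto_circleNormSq_kernelFun (h : IsPythagoreanPair A B) :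
    Tendsto (fun r => ((circleNormSq (kernelFun B s c) r +
      circleNormSq (fun z => A z * szegoSum s (fun w => c w * conj (B w)) z) r : ℝ) : ℂ))
      (𝓝[<] 1) (𝓝 (∑ w ∈ s, conj (c w) * kernelFun B s c w)) := by
  set v := szegoSum s (fun w => c w * conj (B w)) with hv
  have hvd : DifferentiableOn ℂ v (Metric.ball 0 1) := differentiableOn_szegoSum _ _
  have hFd := h.differentiableOn_kernelFun s c
  obtain ⟨M, hM⟩ := exists_norm_szegoSum_le s (fun w => c w * conj (B w))
  have h0 := h.tendsto_circlePairing hvd hvd hM hM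
  have h1 := tendsto_circlePairing_szegoSum hFd s c
  have h2 := tendsto_circlePairing_szegoSum_left (h.right.mul hvd) s c
  have h3 := tendsto_circlePairing_szegoSum hvd s (fun w => c w * conj (B w))
  have h4 : ∑ w ∈ s, conj (c w * conj (B w)) * v w = ∑ w ∈ s, conj (c w) * (B w * v w) :=
    Finset.sum_congr rfl fun w _ => by simp [mul_assoc]
  simp only [Pi.mul_def] at h2
  rw [h4] at h3
  -- The sum is the limit of the self-pairings of `v`, hence real, so the conjugated limit in `h2`
  -- cancels against that in `h3`.
  have h5 : conj (∑ w ∈ s, conj (c w) * (B w * v w)) = ∑ w ∈ s, conj (c w) * (B w * v w) := by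
    refine tendsto_nhds_unique (((Complex.continuous_conj.tendsto _).comp h3).congr' ?_) h3
    filter_upwards [eventually_mem_Ioo_nhdsLT_one] with r hr
    exact (circlePairing_conj_symm v v r hr.1.le (hvd.continuousOn_sphere hr.2)
      (hvd.continuousOn_sphere hr.2)).symm
  rw [h5] at h2
  have h6 := ((h1.sub h2).add h3).add h0
  rw [sub_add_cancel, add_zero] at h6
  refine h6.congr' ?_
  filter_upwards [eventually_mem_Ioo_nhdsLT_one] with r hr
  have c1 := (differentiableOn_szegoSum s c).continuousOn_sphere hr.2
  have c2 := (h.right.mul hvd).continuousOn_sphere hr.2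
  have c3 := hFd.continuousOn_sphere hr.2
  have e1 : circlePairing (kernelFun B s c) (fun z => szegoSum s c z - B z * v z) r = _ :=
    circlePairing_sub_right hr.1.le c1 c2 c3
  have e2 : circlePairing (fun z => szegoSum s c z - B z * v z) (fun z => B z * v z) r = _ :=
    circlePairing_sub_left hr.1.le c1 c2 c2
  have c4 : ContinuousOn (fun z => A z * v z) (Metric.sphere 0 r) :=
    (h.left.mul hvd).continuousOn_sphere hr.2
  rw [Complex.ofReal_add, ← circlePairing_self _ hr.1.le c3, ← circlePairing_self _ hr.1.le c4]
  have e3 : kernelFun B s c = fun z => szegoSum s c z - B z * v z := rfl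
  rw [e3] at e1 ⊢
  rw [e1, e2]
  ring

end IsPythagoreanPair

/-! ### Kernel combinations in `H(b)` -/

section Space

variable (b : hInftyUnitBall)

/-- The finite linear combinations of the reproducing kernels of `H(b)`. -/
def kernelSum (s : Finset 𝔻) (c : 𝔻 → ℂ) : DeBrangesRovnyak b :=
  ∑ w ∈ s, c w • RKHS.kerFun (DeBrangesRovnyak b) w 1

theorem kerFun_one_apply (w z : 𝔻) :
    RKHS.kerFun (DeBrangesRovnyak b) w 1 z =
      (1 - conj ((b : 𝔻 → ℂ) w) * (b : 𝔻 → ℂ) z) / (1 - conj (w : ℂ) * (z : ℂ)) := by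
  rw [RKHS.kerFun_apply, RKHS.OfKernel.kernel_ofKernel]
  simp [dbrKernel]

theorem sum_smul_apply (s : Finset 𝔻) (c : 𝔻 → ℂ) (F : 𝔻 → DeBrangesRovnyak b) (z : 𝔻) :
    (∑ w ∈ s, c w • F w) z = ∑ w ∈ s, c w * F w z := by
  rw [← RKHS.coeCLM_apply, map_sum, Finset.sum_apply]
  simp

theorem kernelSum_apply (s : Finset 𝔻) (c : 𝔻 → ℂ) (z : 𝔻) :
    kernelSum b s c z = IsPythagoreanPair.kernelFun (discExt (b : 𝔻 → ℂ)) s c z := by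
  rw [kernelSum, sum_smul_apply, IsPythagoreanPair.kernelFun, szegoSum, szegoSum, Finset.mul_sum,
    ← Finset.sum_sub_distrib]
  refine Finset.sum_congr rfl fun w _ => ?_
  rw [kerFun_one_apply, szegoKernel, discExt_coe, discExt_coe]
  ring

theorem inner_kernelSum_left (s : Finset 𝔻) (c : 𝔻 → ℂ) (F : DeBrangesRovnyak b) :
    inner ℂ (kernelSum b s c) F = ∑ w ∈ s, conj (c w) * F w := by
  rw [kernelSum, sum_inner]
  refine Finset.sum_congr rfl fun w _ => ?_
  rw [inner_smul_left, RKHS.kerFun_inner]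
  simp

theorem exists_norm_sub_kernelSum_lt (F : DeBrangesRovnyak b) {ε : ℝ} (hε : 0 < ε) :
    ∃ s c, ‖F - kernelSum b s c‖ < ε := by
  have hd := RKHS.kerFun_dense (𝕜 := ℂ) (DeBrangesRovnyak b)
  have hF : F ∈ closure (Submodule.span ℂ
      {x : DeBrangesRovnyak b | ∃ w v, RKHS.kerFun (DeBrangesRovnyak b) w v = x} :
      Set (DeBrangesRovnyak b)) := by
    rw [← Submodule.topologicalClosure_coe]
    have : F ∈ (⊤ : Submodule ℂ (DeBrangesRovnyak b)) := trivial
    rw [← hd] at this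
    exact this
  obtain ⟨G, hG, hFG⟩ := Metric.mem_closure_iff.1 hF ε hε
  rw [dist_eq_norm] at hFG
  have hle : Submodule.span ℂ
      {x : DeBrangesRovnyak b | ∃ w v, RKHS.kerFun (DeBrangesRovnyak b) w v = x} ≤
      Submodule.span ℂ (range fun w => RKHS.kerFun (DeBrangesRovnyak b) w 1) := by
    rw [Submodule.span_le]
    rintro _ ⟨w, v, rfl⟩
    have : RKHS.kerFun (DeBrangesRovnyak b) w v = v • RKHS.kerFun (DeBrangesRovnyak b) w 1 := by
      rw [← map_smul, smul_eq_mul, mul_one]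
    rw [this]
    exact Submodule.smul_mem _ _ (Submodule.subset_span (mem_range_self w))
  obtain ⟨c, hc⟩ := Finsupp.mem_span_range_iff_exists_finsupp.1 (hle hG)
  have hc' : kernelSum b c.support c = G := hc
  exact ⟨c.support, c, by rwa [hc']⟩

theorem discExt_kernelSum (s : Finset 𝔻) (c : 𝔻 → ℂ) {z : ℂ} (hz : ‖z‖ < 1) :
    discExt (kernelSum b s c) z = IsPythagoreanPair.kernelFun (discExt (b : 𝔻 → ℂ)) s c z := by
  rw [discExt, dif_pos hz, kernelSum_apply, Complex.UnitDisc.coe_mk]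

/-- The isometric description of the norm on kernel combinations. -/
theorem tendsto_circleNormSq_norm_kernelSum {A : ℂ → ℂ}
    (h : IsPythagoreanPair A (discExt (b : 𝔻 → ℂ))) (s : Finset 𝔻) (c : 𝔻 → ℂ) :
    Tendsto (fun r => circleNormSq (IsPythagoreanPair.kernelFun (discExt (b : 𝔻 → ℂ)) s c) r +
      circleNormSq (fun z => A z *
        szegoSum s (fun w => c w * conj (discExt (b : 𝔻 → ℂ) w)) z) r)
      (𝓝[<] 1) (𝓝 (‖kernelSum b s c‖ ^ 2)) := by
  have h1 := h.tendsto_circleNormSq_kernelFun s c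
  have h2 : ∑ w ∈ s, conj (c w) * IsPythagoreanPair.kernelFun (discExt (b : 𝔻 → ℂ)) s c w =
      ((‖kernelSum b s c‖ ^ 2 : ℝ) : ℂ) := by
    have h3 := inner_self_eq_norm_sq_to_K (𝕜 := ℂ) (kernelSum b s c)
    rw [inner_kernelSum_left] at h3
    rw [Finset.sum_congr rfl fun w _ => by rw [← kernelSum_apply], h3]
    push_cast
    rfl
  rw [h2] at h1
  exact (Complex.continuous_re.tendsto _).comp h1

end Space

/-! ### Membership in `H(b)`, the embedding in `H²`, functionals on `H(b)` -/

open IsPythagoreanPair (kernelFun)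

/-- Cauchy–Schwarz in `ℝ²` for `(√a, √c)` and `(√b, √d)`. It merges two `H²` pairings into one
estimate against the `H(b)` norm. -/
theorem sqrt_mul_sqrt_add_le {a b c d : ℝ} (ha : 0 ≤ a) (hb : 0 ≤ b) (hc : 0 ≤ c) (hd : 0 ≤ d) :
    √a * √b + √c * √d ≤ √(a + c) * √(b + d) := by
  rw [← Real.sqrt_mul (add_nonneg ha hc)]
  refine Real.le_sqrt_of_sq_le ?_
  have h1 := Real.sq_sqrt ha
  have h2 := Real.sq_sqrt hb
  have h3 := Real.sq_sqrt hc
  have h4 := Real.sq_sqrt hd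
  rw [← h1, ← h2, ← h3, ← h4]
  simp only [Real.sqrt_sq, Real.sqrt_nonneg]
  nlinarith [sq_nonneg (√a * √d - √c * √b)]

section Pair

variable {b : hInftyUnitBall}

/-- A function belongs to `H(b)` as soon as it defines a bounded functional on the combinations of
reproducing kernels. -/
theorem mem_dbrFunctions_of_norm_sum_le {f : 𝔻 → ℂ} (C : ℝ)
    (hf : ∀ s c, ‖∑ w ∈ s, conj (c w) * f w‖ ≤ C * ‖kernelSum b s c‖) : f ∈ dbrFunctions b := by
  set e : (𝔻 →₀ ℂ) →ₗ[ℂ] DeBrangesRovnyak b :=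
    Finsupp.linearCombination ℂ fun w => RKHS.kerFun (DeBrangesRovnyak b) w 1 with he
  -- If `f` were already in `H(b)`, `l c` would be `⟨f, e c⟩`. The bound extends `l` along the dense
  -- range of `e`, and the Riesz vector of the extension has the values of `f`.
  set l : (𝔻 →₀ ℂ) →ₗ[ℂ] ℂ := Finsupp.linearCombination ℂ fun w => conj (f w) with hl
  have hec : ∀ c, e c = kernelSum b c.support c := fun c => Finsupp.linearCombination_apply ℂ c
  have hd : DenseRange e := by
    rw [Metric.denseRange_iff]
    intro F ε hε
    obtain ⟨s, c, hsc⟩ := exists_norm_sub_kernelSum_lt b F hε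
    refine ⟨∑ w ∈ s, Finsupp.single w (c w), ?_⟩
    rw [dist_eq_norm, map_sum]
    simpa [he, Finsupp.linearCombination_single, kernelSum] using hsc
  have hn : ∀ c, ‖l c‖ ≤ C * ‖e c‖ := by
    intro c
    rw [hec]
    refine le_trans (le_of_eq ?_) (hf c.support c)
    rw [← RCLike.norm_conj, hl, Finsupp.linearCombination_apply, Finsupp.sum, map_sum]
    simp
  refine ⟨(InnerProductSpace.toDual ℂ (DeBrangesRovnyak b)).symm (l.extendOfNorm e), ?_⟩
  ext w
  have h1 : inner ℂ ((InnerProductSpace.toDual ℂ (DeBrangesRovnyak b)).symm (l.extendOfNorm e))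
      (RKHS.kerFun (DeBrangesRovnyak b) w 1) = conj (f w) := by
    rw [InnerProductSpace.toDual_symm_apply]
    have h2 := LinearMap.extendOfNorm_eq (f := l) hd ⟨C, hn⟩ (Finsupp.single w 1)
    simpa [he, hl] using h2
  rw [RKHS.inner_kerFun] at h1
  have h3 := congrArg conj h1
  simpa using h3

/-- The kernel is bounded on the diagonal over smaller discs, so norm convergence in `H(b)` is
locally uniform convergence. -/
theorem norm_kerFun_le {r : ℝ} (hr1 : r < 1) (w : 𝔻) (hw : ‖(w : ℂ)‖ ≤ r) :
    ‖RKHS.kerFun (DeBrangesRovnyak b) w‖ ≤ √(2 / (1 - r)) := by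
  rw [RKHS.norm_kerFun_eq_sqrt_norm_kernel, RKHS.OfKernel.kernel_ofKernel]
  refine Real.sqrt_le_sqrt ?_
  have hb := b.2.2 w
  have h1 : ‖1 - conj ((b : 𝔻 → ℂ) w) * (b : 𝔻 → ℂ) w‖ ≤ 2 := by
    refine (norm_sub_le _ _).trans ?_
    rw [norm_one, norm_mul, RCLike.norm_conj]
    nlinarith [norm_nonneg ((b : 𝔻 → ℂ) w)]
  have h2 : 1 - r ≤ ‖1 - conj (w : ℂ) * (w : ℂ)‖ := by
    have := norm_sub_norm_le (1 : ℂ) (conj (w : ℂ) * w)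
    rw [norm_one, norm_mul, RCLike.norm_conj] at this
    nlinarith [norm_nonneg (w : ℂ)]
  have h3 : 0 < 1 - r := by linarith
  rw [dbrKernel, Matrix.of_apply, norm_smul, norm_one, mul_one, norm_div]
  gcongr

theorem tendstoUniformlyOn_discExt {F : DeBrangesRovnyak b} {G : ℕ → DeBrangesRovnyak b}
    (hG : Tendsto G atTop (𝓝 F)) {r : ℝ} (hr : r < 1) :
    TendstoUniformlyOn (fun n => discExt (G n)) (discExt F) atTop (Metric.closedBall 0 r) := by
  have h := RKHS.tendstoUniformlyOn_of_norm_kerFun_le (s := {w : 𝔻 | ‖(w : ℂ)‖ ≤ r})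
    (fun w hw => norm_kerFun_le hr w hw) hG
  rw [Metric.tendstoUniformlyOn_iff] at h ⊢
  intro ε hε
  filter_upwards [h ε hε] with n hn z hz
  have hz' : ‖z‖ ≤ r := by simpa using hz
  have hz1 : ‖z‖ < 1 := hz'.trans_lt hr
  have := hn (Complex.UnitDisc.mk z hz1) hz'
  simpa [discExt, hz1] using this

theorem exists_tendsto_kernelSum (F : DeBrangesRovnyak b) :
    ∃ (s : ℕ → Finset 𝔻) (c : ℕ → 𝔻 → ℂ), Tendsto (fun n => kernelSum b (s n) (c n)) atTop (𝓝 F) := by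
  choose s c h using fun n : ℕ =>
    exists_norm_sub_kernelSum_lt b F (Nat.one_div_pos_of_nat (α := ℝ) (n := n))
  refine ⟨s, c, ?_⟩
  rw [tendsto_iff_norm_sub_tendsto_zero]
  refine squeeze_zero (fun _ => norm_nonneg _) (fun n => ?_) tendsto_one_div_add_atTop_nhds_zero_nat
  rw [norm_sub_rev]
  exact (h n).le

variable {A : ℂ → ℂ} (h : IsPythagoreanPair A (discExt (b : 𝔻 → ℂ)))

include h

/-- Drop the nonnegative `A v` term in the norm formula; as quadratic means increase with the
radius, each is at most the limit. -/
theorem circleNormSq_kernelFun_le (s : Finset 𝔻) (c : 𝔻 → ℂ) {r : ℝ} (hr0 : 0 < r) (hr1 : r < 1) :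
    circleNormSq (kernelFun (discExt (b : 𝔻 → ℂ)) s c) r ≤ ‖kernelSum b s c‖ ^ 2 := by
  refine ge_of_tendsto (tendsto_circleNormSq_norm_kernelSum b h s c) ?_
  filter_upwards [self_mem_nhdsWithin, (eventually_gt_nhds hr1).filter_mono nhdsWithin_le_nhds]
    with R hR1 hrR
  exact (circleNormSq_le_circleNormSq hr0 hrR.le hR1 (h.differentiableOn_kernelFun s c)).trans
    (le_add_of_nonneg_right (circleNormSq_nonneg _ _))

theorem continuousOn_discExt_sphere (F : DeBrangesRovnyak b) {r : ℝ} (hr : r < 1) :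
    ContinuousOn (discExt F) (Metric.sphere 0 r) := by
  obtain ⟨s, c, hsc⟩ := exists_tendsto_kernelSum F
  refine ((tendstoUniformlyOn_discExt hsc hr).mono Metric.sphere_subset_closedBall).continuousOn
    (Frequently.of_forall fun n => ?_)
  refine ((h.differentiableOn_kernelFun (s n) (c n)).continuousOn_sphere hr).congr fun z hz => ?_
  exact discExt_kernelSum b _ _ (by rwa [mem_sphere_zero_iff_norm.1 hz])

/-- `H(b)` is contractively contained in the Hardy space `H²`. -/
theorem circleNormSq_discExt_le (F : DeBrangesRovnyak b) {r : ℝ} (hr0 : 0 < r) (hr1 : r < 1) :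
    circleNormSq (discExt F) r ≤ ‖F‖ ^ 2 := by
  obtain ⟨s, c, hsc⟩ := exists_tendsto_kernelSum F
  have hu := tendstoUniformlyOn_discExt hsc hr1
  have hc := continuousOn_discExt_sphere h F hr1
  obtain ⟨M, hM⟩ := (isCompact_sphere (0 : ℂ) r).exists_bound_of_continuousOn hc
  have hbd : ∀ᶠ n in atTop, ∀ z, ‖z‖ = r →
      ‖‖discExt (kernelSum b (s n) (c n)) z‖ ^ 2‖ ≤ (M + 1) ^ 2 := by
    filter_upwards [Metric.tendstoUniformlyOn_iff.1 hu 1 one_pos] with n hn z hz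
    have h1 := hn z (by simp [hz])
    have h2 := hM z (by simpa using hz)
    rw [norm_pow, norm_norm]
    rw [dist_eq_norm, norm_sub_rev] at h1
    have h3 := norm_le_norm_add_norm_sub' (discExt (kernelSum b (s n) (c n)) z) (discExt F z)
    gcongr
    linarith
  have hlim : Tendsto (fun n => circleNormSq (discExt (kernelSum b (s n) (c n))) r) atTop
      (𝓝 (circleNormSq (discExt F) r)) := by
    refine tendsto_circleAverage_of_bounded hr0.le (Eventually.of_forall fun n =>
      ((continuousOn_discExt_sphere h _ hr1).norm.pow 2)) hbd fun z hz => ?_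
    exact ((hu.tendsto_at (by simp [hz])).norm).pow 2
  refine le_of_tendsto_of_tendsto' hlim (hsc.norm.pow 2) fun n => ?_
  refine le_trans (le_of_eq ?_) (circleNormSq_kernelFun_le h (s n) (c n) hr0 hr1)
  refine circleAverage_congr_of_norm_eq hr0.le fun z hz => ?_
  rw [discExt_kernelSum b _ _ (by rwa [hz])]

/-- The functional `F ↦ ⟨F, b y⟩` of `H²` has norm at most `‖a y‖₂` on `H(b)`. -/
theorem norm_le_of_tendsto_circlePairing (F : DeBrangesRovnyak b) {y : ℂ → ℂ} {N S : ℝ} {l : ℂ}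
    (hy : DifferentiableOn ℂ y (Metric.ball 0 1)) (hyN : ∀ z, ‖z‖ < 1 → ‖y z‖ ≤ N)
    (hS : ∀ r, 0 < r → r < 1 → circleNormSq (fun z => A z * y z) r ≤ S)
    (hl : Tendsto (fun r => circlePairing (discExt F) (fun z => discExt (b : 𝔻 → ℂ) z * y z) r)
      (𝓝[<] 1) (𝓝 l)) :
    ‖l‖ ≤ ‖F‖ * √S := by
  set B := discExt (b : 𝔻 → ℂ) with hB
  have hN : 0 ≤ N := (norm_nonneg _).trans (hyN 0 (by simp))
  have hBy : DifferentiableOn ℂ (fun z => B z * y z) (Metric.ball 0 1) := h.right.mul hy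
  have hAy : DifferentiableOn ℂ (fun z => A z * y z) (Metric.ball 0 1) := h.left.mul hy
  -- Approximate `F` by a kernel combination `K`. The error costs `ε N`, as the `H²` norm is at most
  -- the `H(b)` norm and `|B| ≤ 1`. For `K` the pairing is asymptotically `⟨A v, A y⟩`, and the mean
  -- square of `A v` is part of `‖K‖²`.
  have key : ∀ ε > 0, ‖l‖ ≤ ε * N + (‖F‖ + ε) * √S := by
    intro ε hε
    obtain ⟨s, c, hsc⟩ := exists_norm_sub_kernelSum_lt b F hε
    set K := kernelSum b s c with hK
    set v := fun z => A z * szegoSum s (fun w => c w * conj (B w)) z with hv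
    have hvd : DifferentiableOn ℂ v (Metric.ball 0 1) := h.left.mul (differentiableOn_szegoSum _ _)
    have h1 := h.tendsto_circlePairing_kernelFun_mul s c hy hyN
    have h2 := tendsto_circleNormSq_norm_kernelSum b h s c
    have h3 : Tendsto (fun r => ε * N + (‖circlePairing (kernelFun B s c) (fun z => B z * y z) r -
        circlePairing v (fun z => A z * y z) r‖ +
        √(circleNormSq (kernelFun B s c) r + circleNormSq v r) * √S)) (𝓝[<] 1)
        (𝓝 (ε * N + (‖(0 : ℂ)‖ + √(‖K‖ ^ 2) * √S))) :=
      tendsto_const_nhds.add (h1.norm.add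
        (((Real.continuous_sqrt.tendsto _).comp h2).mul_const _))
    have h4 := le_of_tendsto_of_tendsto hl.norm h3 (by
      filter_upwards [eventually_mem_Ioo_nhdsLT_one] with r hr
      have cF := continuousOn_discExt_sphere h F hr.2
      have cK := continuousOn_discExt_sphere h K hr.2
      have cBy := hBy.continuousOn_sphere hr.2
      have cAy := hAy.continuousOn_sphere hr.2
      have cv := hvd.continuousOn_sphere hr.2
      have e1 : circlePairing (discExt K) (fun z => B z * y z) r =
          circlePairing (kernelFun B s c) (fun z => B z * y z) r :=
        circleAverage_congr_of_norm_eq hr.1.le fun z hz => by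
          rw [hK, discExt_kernelSum b _ _ (by rw [hz]; exact hr.2)]
      have e2 := circlePairing_sub_left hr.1.le cF cK cBy
      have e3 : (fun z => discExt F z - discExt K z) = discExt ⇑(F - K) := by
        ext z
        unfold discExt
        split_ifs <;> simp
      have e4 := norm_circlePairing_le (discExt ⇑(F - K)) (fun z => B z * y z) hr.1.le
        (continuousOn_discExt_sphere h _ hr.2) cBy
      have e5 : √(circleNormSq (discExt ⇑(F - K)) r) ≤ ε := by
        refine Real.sqrt_le_iff.2 ⟨hε.le, (circleNormSq_discExt_le h _ hr.1 hr.2).trans ?_⟩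
        gcongr
      have e6 : √(circleNormSq (fun z => B z * y z) r) ≤ N := by
        refine Real.sqrt_le_iff.2 ⟨hN, circleNormSq_le_of_norm_le hr.1.le cBy fun z hz => ?_⟩
        rw [norm_mul]
        have := hyN z (by rw [hz]; exact hr.2)
        have := h.norm_right_le z
        nlinarith [norm_nonneg (y z), norm_nonneg (B z)]
      have e7 := norm_circlePairing_le v (fun z => A z * y z) hr.1.le cv cAy
      have e8 : √(circleNormSq v r) ≤ √(circleNormSq (kernelFun B s c) r + circleNormSq v r) :=
        Real.sqrt_le_sqrt (le_add_of_nonneg_left (circleNormSq_nonneg _ _))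
      have e9 : √(circleNormSq (fun z => A z * y z) r) ≤ √S := Real.sqrt_le_sqrt (hS r hr.1 hr.2)
      rw [e3] at e2
      have e10 : circlePairing (discExt F) (fun z => B z * y z) r =
          circlePairing (discExt ⇑(F - K)) (fun z => B z * y z) r +
          ((circlePairing (kernelFun B s c) (fun z => B z * y z) r -
            circlePairing v (fun z => A z * y z) r) + circlePairing v (fun z => A z * y z) r) := by
        rw [e2, e1]; ring
      rw [e10]
      refine (norm_add_le _ _).trans (add_le_add (e4.trans ?_) ((norm_add_le _ _).trans
        (add_le_add le_rfl (e7.trans ?_))))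
      · exact mul_le_mul e5 e6 (Real.sqrt_nonneg _) hε.le
      · exact mul_le_mul e8 e9 (Real.sqrt_nonneg _) (Real.sqrt_nonneg _))
    rw [norm_zero, zero_add, Real.sqrt_sq (norm_nonneg _)] at h4
    refine h4.trans ?_
    gcongr
    calc ‖K‖ ≤ ‖F‖ + ‖F - K‖ := norm_le_norm_add_norm_sub _ _
      _ ≤ ‖F‖ + ε := by gcongr
  have hlim : Tendsto (fun ε : ℝ => ε * N + (‖F‖ + ε) * √S) (𝓝[>] 0) (𝓝 (0 * N + (‖F‖ + 0) * √S)) := by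
    have : Continuous fun ε : ℝ => ε * N + (‖F‖ + ε) * √S := by fun_prop
    exact (this.tendsto 0).mono_left nhdsWithin_le_nhds
  have := ge_of_tendsto hlim (eventually_mem_nhdsWithin.mono fun ε hε => key ε hε)
  simpa using this

/-- If `f` and `f φ` have bounded quadratic means, with `A φ = b`, then `f` belongs to `H(b)`. -/
theorem mem_dbrFunctions_of_circleNormSq_le {f : 𝔻 → ℂ} {φ : ℂ → ℂ} {C : ℝ}
    (hf : IsAnalyticOnDisc f) (hφ : ContinuousOn φ (Metric.ball 0 1))
    (hAφ : ∀ z, ‖z‖ < 1 → A z * φ z = discExt (b : 𝔻 → ℂ) z)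
    (hC : ∀ r, 0 < r → r < 1 →
      circleNormSq (discExt f) r + circleNormSq (fun z => discExt f z * φ z) r ≤ C) :
    f ∈ dbrFunctions b := by
  set B := discExt (b : 𝔻 → ℂ) with hB
  set f' := discExt f with hf'
  refine mem_dbrFunctions_of_norm_sum_le (√C) fun s c => ?_
  set v := szegoSum s (fun w => c w * conj (B w)) with hv
  have hvd : DifferentiableOn ℂ v (Metric.ball 0 1) := differentiableOn_szegoSum _ _
  have h1 := (tendsto_circlePairing_szegoSum (y := f') hf s c).norm
  have h2 := tendsto_circleNormSq_norm_kernelSum b h s c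
  have h3 := ((Real.continuous_sqrt.tendsto _).comp h2).const_mul (√C)
  have h4 := le_of_tendsto_of_tendsto h1 h3 (by
    filter_upwards [eventually_mem_Ioo_nhdsLT_one] with r hr
    have cf : ContinuousOn f' (Metric.sphere 0 r) := DifferentiableOn.continuousOn_sphere hf hr.2
    have cφ : ContinuousOn φ (Metric.sphere 0 r) := hφ.mono fun z hz => by
      simpa [mem_sphere_zero_iff_norm.1 hz] using hr.2
    have cA := h.left.continuousOn_sphere hr.2
    have cB := h.right.continuousOn_sphere hr.2
    have cv := hvd.continuousOn_sphere hr.2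
    have cg := (differentiableOn_szegoSum s c).continuousOn_sphere hr.2
    have cK := (h.differentiableOn_kernelFun s c).continuousOn_sphere hr.2
    have cBv : ContinuousOn (fun z => B z * v z) (Metric.sphere 0 r) := cB.mul cv
    have cAv : ContinuousOn (fun z => A z * v z) (Metric.sphere 0 r) := cA.mul cv
    have cfφ : ContinuousOn (fun z => f' z * conj (φ z)) (Metric.sphere 0 r) :=
      cf.mul (Complex.continuous_conj.comp_continuousOn cφ)
    have e1 : circlePairing f' (kernelFun B s c) r = _ := circlePairing_sub_right hr.1.le cg cBv cf
    -- Since `B = A φ`, the factor `conj φ` can be moved onto `f`. The product is no longer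
    -- analytic, but only its modulus is used afterwards.
    have e2 : circlePairing f' (fun z => B z * v z) r =
        circlePairing (fun z => f' z * conj (φ z)) (fun z => A z * v z) r := by
      refine circleAverage_congr_of_norm_eq hr.1.le fun z hz => ?_
      have := hAφ z (by rw [hz]; exact hr.2)
      simp only [← this, map_mul]
      ring
    have e3 := norm_circlePairing_le f' (kernelFun B s c) hr.1.le cf cK
    have e4 := norm_circlePairing_le (fun z => f' z * conj (φ z)) (fun z => A z * v z) hr.1.le
      cfφ cAv
    have e5 : circleNormSq (fun z => f' z * conj (φ z)) r = circleNormSq (fun z => f' z * φ z) r := by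
      unfold circleNormSq
      simp
    have e6 : circlePairing f' (szegoSum s c) r = circlePairing f' (kernelFun B s c) r +
        circlePairing (fun z => f' z * conj (φ z)) (fun z => A z * v z) r := by
      rw [← e2, e1]; ring
    rw [e5] at e4
    rw [e6]
    refine (norm_add_le _ _).trans ((add_le_add e3 e4).trans ?_)
    refine (sqrt_mul_sqrt_add_le (circleNormSq_nonneg _ _)
      (circleNormSq_nonneg _ _) (circleNormSq_nonneg _ _) (circleNormSq_nonneg _ _)).trans ?_
    exact mul_le_mul_of_nonneg_right (Real.sqrt_le_sqrt (hC r hr.1 hr.2)) (Real.sqrt_nonneg _))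
  rw [Real.sqrt_sq (norm_nonneg _)] at h4
  simpa [hf', discExt_coe] using h4

end Pair

/-! ### Boundedness of the containment `H^p ⊂ H(b)` -/

/-- Pointwise bound for analytic functions with bounded means of order `p ≥ 1`. -/
theorem norm_le_of_hardyMean_le_one {p : ℝ} (hp : 1 ≤ p) {f : 𝔻 → ℂ} (hf : IsAnalyticOnDisc f)
    (hm : ∀ r, 0 < r → r < 1 → hardyMean p f r ≤ 1) {r : ℝ} (hr0 : 0 ≤ r) (hr1 : r < 1) {z : ℂ}
    (hz : ‖z‖ ≤ r) : ‖discExt f z‖ ≤ (1 + r) / (1 - r) * 2 := by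
  -- Cauchy's formula is used on the circle midway between `r` and `1`, where the kernel is at most
  -- `R / (R - r) = (1 + r) / (1 - r)`.
  set R := (1 + r) / 2 with hR
  have hR0 : 0 < R := by rw [hR]; linarith
  have hR1 : R < 1 := by rw [hR]; linarith
  have hrR : r < R := by rw [hR]; linarith
  have hcf : ContinuousOn (discExt f) (Metric.sphere 0 R) := DifferentiableOn.continuousOn_sphere hf hR1
  have h1 := DiffContOnCl.circleAverage_smul_div (R := R) (c := 0) (f := discExt f) (w := z)
    (by
      rw [abs_of_pos hR0]
      refine DifferentiableOn.diffContOnCl ?_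
      rw [closure_ball _ hR0.ne']
      exact hf.mono (Metric.closedBall_subset_ball hR1))
    (by rw [abs_of_pos hR0]; simpa using hz.trans_lt hrR)
  rw [← h1]
  refine (norm_circleAverage_le _ _).trans ?_
  -- A crude substitute for Hölder: the mean of `|f|` is at most `1 + 1`, the source of the factor
  -- `2`.
  have hpow : ∀ t : ℝ, 0 ≤ t → t ≤ 1 + t ^ p := by
    intro t ht
    rcases le_total t 1 with h | h
    · linarith [Real.rpow_nonneg ht p]
    · have := Real.self_le_rpow_of_one_le h hp
      linarith
  have hpc : ContinuousOn (fun ζ => ‖discExt f ζ‖ ^ p) (Metric.sphere 0 R) :=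
    hcf.norm.rpow_const fun _ _ => Or.inr (by linarith)
  have hk : ∀ ζ : ℂ, ‖ζ‖ = R → ζ - z ≠ 0 := by
    intro ζ hζ h
    rw [sub_eq_zero.1 h] at hζ
    linarith
  calc Real.circleAverage (fun ζ => ‖((ζ - 0) / (ζ - z)) • discExt f ζ‖) 0 R
      ≤ Real.circleAverage (fun ζ => ((1 + r) / (1 - r)) • (1 + ‖discExt f ζ‖ ^ p)) 0 R := by
        refine circleAverage_mono_of_continuousOn hR0.le ?_ ?_ fun ζ hζ => ?_
        · refine ContinuousOn.norm (ContinuousOn.smul (ContinuousOn.div (by fun_prop) (by fun_prop)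
            fun ζ hζ => hk ζ (by simpa using hζ)) hcf)
        · exact (continuousOn_const.add hpc).const_smul ((1 + r) / (1 - r))
        · rw [norm_smul, norm_div, sub_zero, hζ, smul_eq_mul]
          have h2 : R - r ≤ ‖ζ - z‖ := by
            have := norm_sub_norm_le ζ z
            rw [hζ] at this
            linarith
          have h3 : R / ‖ζ - z‖ ≤ (1 + r) / (1 - r) := by
            have h4 : (1 + r) / (1 - r) = R / (R - r) := by
              rw [hR]
              field_simp
              ring
            rw [h4]
            have : 0 < R - r := by linarith
            gcongr
          exact mul_le_mul h3 (hpow _ (norm_nonneg _)) (norm_nonneg _)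
            (div_nonneg (by linarith) (by linarith))
    _ ≤ (1 + r) / (1 - r) * 2 := by
        rw [Real.circleAverage_fun_smul, Real.circleAverage_fun_add
          (circleIntegrable_const _ _ _) (hpc.circleIntegrable hR0.le), Real.circleAverage_const,
          smul_eq_mul]
        refine mul_le_mul_of_nonneg_left ?_ (div_nonneg (by linarith) (by linarith))
        have := hm R hR0 hR1
        unfold hardyMean at this
        linarith

theorem circleAverage_const_mul_add_one {S : ℂ → ℝ} {r c d : ℝ} (hr : 0 ≤ r)
    (hS : ContinuousOn S (Metric.sphere 0 r)) :
    Real.circleAverage (fun z => c * (d * S z + 1)) 0 r = c * (d * Real.circleAverage S 0 r + 1) := by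
  have h1 : Real.circleAverage (fun z => c * (d * S z + 1)) 0 r =
      c * Real.circleAverage (fun z => d * S z + 1) 0 r := Real.circleAverage_fun_smul (a := c)
  have h2 : Real.circleAverage (fun z => d * S z + 1) 0 r =
      Real.circleAverage (fun z => d * S z) 0 r + Real.circleAverage (fun _ => (1 : ℝ)) 0 r :=
    Real.circleAverage_fun_add ((continuousOn_const.mul hS).circleIntegrable hr)
      (circleIntegrable_const _ _ _)
  have h3 : Real.circleAverage (fun z => d * S z) 0 r = d * Real.circleAverage S 0 r :=
    Real.circleAverage_fun_smul (a := d)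
  rw [h1, h2, h3, Real.circleAverage_const]

/-- Weighted Hölder with the roots cleared. With weights of bounded total mass it controls means of
order `p` of a series linearly in the means of its terms. -/
theorem rpow_sum_mul_le {ι : Type*} (s : Finset ι) {p : ℝ} (hp : 1 ≤ p) (w f : ι → ℝ)
    (hw : ∀ i, 0 ≤ w i) (hf : ∀ i, 0 ≤ f i) :
    (∑ i ∈ s, w i * f i) ^ p ≤ (∑ i ∈ s, w i) ^ (p - 1) * ∑ i ∈ s, w i * f i ^ p := by
  have hp0 : 0 < p := by linarith
  have h1 : 0 ≤ ∑ i ∈ s, w i := Finset.sum_nonneg fun i _ => hw i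
  have h2 : 0 ≤ ∑ i ∈ s, w i * f i ^ p :=
    Finset.sum_nonneg fun i _ => mul_nonneg (hw i) (Real.rpow_nonneg (hf i) _)
  have h3 := Real.rpow_le_rpow (Finset.sum_nonneg fun i _ => mul_nonneg (hw i) (hf i))
    (Real.inner_le_weight_mul_Lp_of_nonneg s hp w f hw hf) hp0.le
  rw [Real.mul_rpow (Real.rpow_nonneg h1 _) (Real.rpow_nonneg h2 _), ← Real.rpow_mul h1,
    ← Real.rpow_mul h2, inv_mul_cancel₀ hp0.ne', Real.rpow_one, sub_mul, one_mul,
    inv_mul_cancel₀ hp0.ne'] at h3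
  exact h3

/-- The analytic functions all of whose means of order `p` are at most `1`. -/
abbrev HardyBall (p : ℝ) : Type :=
  {f : 𝔻 → ℂ // IsAnalyticOnDisc f ∧ ∀ r, 0 < r → r < 1 → hardyMean p f r ≤ 1}

/-- The sum of an absolutely convergent series of elements of the unit ball of `H^p`. -/
def hardySeries {p : ℝ} (x : lp (fun _ : HardyBall p => ℂ) 1) (z : 𝔻) : ℂ :=
  ∑' f : HardyBall p, x f * f.1 z

section Series

variable {p : ℝ} (hp : 1 ≤ p) (x : lp (fun _ : HardyBall p => ℂ) 1)

theorem summable_norm_lp_one : Summable fun f => ‖x f‖ := by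
  simpa using (lp.memℓp x).summable (by simp)

theorem norm_lp_one_eq_tsum : ‖x‖ = ∑' f, ‖x f‖ := by
  simpa using lp.norm_eq_tsum_rpow (p := 1) (by simp) x

theorem discExt_hardySeries {z : ℂ} (hz : ‖z‖ < 1) :
    discExt (hardySeries x) z = ∑' f : HardyBall p, x f * discExt f.1 z := by
  simp [discExt, hz, hardySeries]

include hp

theorem norm_mul_discExt_le (f : HardyBall p) {r : ℝ} (hr0 : 0 ≤ r) (hr1 : r < 1) {z : ℂ}
    (hz : ‖z‖ ≤ r) : ‖x f * discExt f.1 z‖ ≤ ‖x f‖ * ((1 + r) / (1 - r) * 2) := by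
  rw [norm_mul]
  gcongr
  exact norm_le_of_hardyMean_le_one hp f.2.1 f.2.2 hr0 hr1 hz

theorem summable_mul_discExt {z : ℂ} (hz : ‖z‖ < 1) :
    Summable fun f : HardyBall p => x f * discExt f.1 z :=
  .of_norm_bounded ((summable_norm_lp_one x).mul_right _) fun f =>
    norm_mul_discExt_le hp x f (norm_nonneg z) hz le_rfl

theorem norm_hardySeries_le (z : 𝔻) :
    ‖hardySeries x z‖ ≤ ‖x‖ * ((1 + ‖(z : ℂ)‖) / (1 - ‖(z : ℂ)‖) * 2) := by
  rw [norm_lp_one_eq_tsum, ← tsum_mul_right]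
  refine tsum_of_norm_bounded ((summable_norm_lp_one x).mul_right _).hasSum fun f => ?_
  have := norm_mul_discExt_le hp x f (norm_nonneg (z : ℂ)) z.norm_lt_one le_rfl
  rwa [discExt_coe] at this

theorem isAnalyticOnDisc_hardySeries : IsAnalyticOnDisc (hardySeries x) := by
  intro z hz
  have hz1 : ‖z‖ < 1 := by simpa using hz
  set r := (1 + ‖z‖) / 2 with hr
  have hr0 : 0 ≤ r := by have := norm_nonneg z; rw [hr]; linarith
  have hr1 : r < 1 := by rw [hr]; linarith
  have hzr : z ∈ Metric.ball (0 : ℂ) r := by rw [mem_ball_zero_iff, hr]; linarith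
  have h1 : DifferentiableOn ℂ (fun w => ∑' f : HardyBall p, x f * discExt f.1 w)
      (Metric.ball 0 r) := by
    refine Complex.differentiableOn_tsum_of_summable_norm
      ((summable_norm_lp_one x).mul_right ((1 + r) / (1 - r) * 2)) (fun f => ?_) Metric.isOpen_ball
      fun f w hw => norm_mul_discExt_le hp x f hr0 hr1 (mem_ball_zero_iff.1 hw).le
    exact (DifferentiableOn.mono f.2.1 (Metric.ball_subset_ball hr1.le)).const_mul (x f)
  have h2 : DifferentiableOn ℂ (discExt (hardySeries x)) (Metric.ball 0 r) :=
    h1.congr fun w hw => discExt_hardySeries x ((mem_ball_zero_iff.1 hw).trans hr1)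
  exact (h2.differentiableAt (Metric.isOpen_ball.mem_nhds hzr)).differentiableWithinAt

theorem hardySeries_mem_hardySpace : hardySeries x ∈ hardySpace p := by
  have hp0 : 0 ≤ p := by linarith
  refine ⟨isAnalyticOnDisc_hardySeries hp x, 2 ^ p * (‖x‖ ^ (p - 1) * ‖x‖ + 1), ?_⟩
  rintro _ ⟨r, ⟨hr0, hr1⟩, rfl⟩
  have hu := tendstoUniformlyOn_tsum ((summable_norm_lp_one x).mul_right ((1 + r) / (1 - r) * 2))
    (f := fun (f : HardyBall p) z => x f * discExt f.1 z) (s := Metric.sphere 0 r)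
    fun f z hz => norm_mul_discExt_le hp x f hr0.le hr1 (mem_sphere_zero_iff_norm.1 hz).le
  -- A finite partial sum within distance `1` of the series on the whole circle. The set `A` depends
  -- on `r`, but it enters the final bound only through `∑ ‖x f‖ ≤ ‖x‖`.
  obtain ⟨A, hA⟩ := (Metric.tendstoUniformlyOn_iff.1 hu 1 one_pos).exists
  have hcf : ∀ f : HardyBall p, ContinuousOn (fun z => ‖discExt f.1 z‖ ^ p) (Metric.sphere 0 r) :=
    fun f => (DifferentiableOn.continuousOn_sphere f.2.1 hr1).norm.rpow_const
      fun _ _ => Or.inr hp0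
  have hL : ∑ f ∈ A, ‖x f‖ ≤ ‖x‖ := by
    rw [norm_lp_one_eq_tsum]
    exact (summable_norm_lp_one x).sum_le_tsum A fun _ _ => norm_nonneg _
  have hpt : ∀ z, ‖z‖ = r → ‖discExt (hardySeries x) z‖ ^ p ≤
      2 ^ p * (‖x‖ ^ (p - 1) * ∑ f ∈ A, ‖x f‖ * ‖discExt f.1 z‖ ^ p + 1) := by
    intro z hz
    rw [discExt_hardySeries x (by rwa [hz])]
    have h1 := hA z (by simpa using hz)
    rw [dist_eq_norm] at h1
    set S := ∑ f ∈ A, ‖x f‖ * ‖discExt f.1 z‖ with hS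
    have hS0 : 0 ≤ S := Finset.sum_nonneg fun f _ => by positivity
    have h2 : ‖∑ f ∈ A, x f * discExt f.1 z‖ ≤ S :=
      norm_sum_le_of_le _ fun f _ => (norm_mul _ _).le
    have h3 : ‖∑' f : HardyBall p, x f * discExt f.1 z‖ ≤ 2 * max S 1 := by
      have := norm_le_norm_add_norm_sub' (∑' f : HardyBall p, x f * discExt f.1 z)
        (∑ f ∈ A, x f * discExt f.1 z)
      have := le_max_left S 1
      have := le_max_right S 1
      linarith
    have h4 : max S 1 ^ p ≤ S ^ p + 1 := by
      rcases max_cases S 1 with h | h <;> rw [h.1]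
      · linarith
      · rw [Real.one_rpow]
        linarith [Real.rpow_nonneg hS0 p]
    have h5 : S ^ p ≤ ‖x‖ ^ (p - 1) * ∑ f ∈ A, ‖x f‖ * ‖discExt f.1 z‖ ^ p := by
      refine (rpow_sum_mul_le A hp _ _ (fun _ => norm_nonneg _) fun _ => norm_nonneg _).trans ?_
      refine mul_le_mul_of_nonneg_right (Real.rpow_le_rpow (Finset.sum_nonneg fun _ _ =>
        norm_nonneg _) hL (by linarith)) (Finset.sum_nonneg fun f _ => by positivity)
    calc _ ≤ (2 * max S 1) ^ p := Real.rpow_le_rpow (norm_nonneg _) h3 hp0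
      _ = 2 ^ p * max S 1 ^ p := Real.mul_rpow zero_le_two (by positivity)
      _ ≤ _ := by
        refine mul_le_mul_of_nonneg_left ?_ (by positivity)
        linarith
  have hsc : ContinuousOn (fun z => ∑ f ∈ A, ‖x f‖ * ‖discExt f.1 z‖ ^ p) (Metric.sphere 0 r) :=
    continuousOn_finsetSum _ fun f _ => continuousOn_const.mul (hcf f)
  calc hardyMean p (hardySeries x) r
      ≤ Real.circleAverage (fun z => 2 ^ p * (‖x‖ ^ (p - 1) *
          (∑ f ∈ A, ‖x f‖ * ‖discExt f.1 z‖ ^ p) + 1)) 0 r := by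
        refine circleAverage_mono_of_continuousOn hr0.le ?_ ?_ hpt
        · exact (DifferentiableOn.continuousOn_sphere (isAnalyticOnDisc_hardySeries hp x)
            hr1).norm.rpow_const fun _ _ => Or.inr hp0
        · exact continuousOn_const.mul ((continuousOn_const.mul hsc).add continuousOn_const)
    _ = 2 ^ p * (‖x‖ ^ (p - 1) * (∑ f ∈ A, ‖x f‖ * hardyMean p f.1 r) + 1) := by
        rw [circleAverage_const_mul_add_one hr0.le hsc]
        congr 3
        refine (Real.circleAverage_fun_sum fun f _ =>
          (continuousOn_const.mul (hcf f)).circleIntegrable hr0.le).trans ?_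
        refine Finset.sum_congr rfl fun f _ => ?_
        exact Real.circleAverage_fun_smul (a := ‖x f‖)
    _ ≤ 2 ^ p * (‖x‖ ^ (p - 1) * ‖x‖ + 1) := by
        have : ∑ f ∈ A, ‖x f‖ * hardyMean p f.1 r ≤ ‖x‖ :=
          (Finset.sum_le_sum fun f _ => mul_le_of_le_one_right (norm_nonneg _)
            (f.2.2 r hr0 hr1)).trans hL
        gcongr

end Series

/-- By the closed graph theorem, a containment of `H^p` in `H(b)` is bounded. -/
theorem exists_norm_le_of_hardySpace_subset {b : hInftyUnitBall} {p : ℝ} (hp : 1 ≤ p)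
    (h : hardySpace p ⊆ dbrFunctions b) :
    ∃ C, 0 ≤ C ∧ ∀ F : DeBrangesRovnyak b, IsAnalyticOnDisc F →
      (∀ r, 0 < r → r < 1 → hardyMean p F r ≤ 1) → ‖F‖ ≤ C := by
  -- The closed graph theorem is applied on `ℓ¹` indexed by the unit ball of `H^p`, which is
  -- complete for free. Unit vectors of `ℓ¹` are sent to the individual members of the ball.
  choose Λ hΛ using fun x : lp (fun _ : HardyBall p => ℂ) 1 =>
    h (hardySeries_mem_hardySpace hp x)
  have hΛ' : ∀ x z, Λ x z = ∑' f : HardyBall p, x f * discExt f.1 z := fun x z => by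
    have := congrFun (hΛ x) z
    simp only [discExt_coe]
    exact this
  set L : lp (fun _ : HardyBall p => ℂ) 1 →ₗ[ℂ] DeBrangesRovnyak b :=
    { toFun := Λ
      map_add' := fun x y => by
        ext z
        rw [RKHS.coe_add, Pi.add_apply, hΛ', hΛ', hΛ', ← (summable_mul_discExt hp x
          z.norm_lt_one).tsum_add (summable_mul_discExt hp y z.norm_lt_one)]
        simp [add_mul]
      map_smul' := fun c x => by
        ext z
        rw [RKHS.coe_smul, Pi.smul_apply, hΛ', RingHom.id_apply, hΛ', smul_eq_mul,
          ← tsum_mul_left]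
        simp [mul_assoc] } with hL
  have hcont : Continuous L := by
    -- The graph is closed because evaluation at each point is continuous both on `H(b)` and,
    -- through the series, on `ℓ¹`.
    refine L.continuous_of_seq_closed_graph fun u x y hu hy => ?_
    ext z
    have h1 : Tendsto (fun n => L (u n) z) atTop (𝓝 (y z)) :=
      ((RKHS.continuous_eval (H := DeBrangesRovnyak b) z).tendsto y).comp hy
    have h2 : Tendsto (fun n => L (u n) z) atTop (𝓝 (L x z)) := by
      rw [tendsto_iff_norm_sub_tendsto_zero]
      have h0 := (tendsto_iff_norm_sub_tendsto_zero.1 hu).mul_const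
        ((1 + ‖(z : ℂ)‖) / (1 - ‖(z : ℂ)‖) * 2)
      rw [zero_mul] at h0
      refine squeeze_zero (fun _ => norm_nonneg _) (fun n => ?_) h0
      · have h3 : L (u n) z - L x z = L (u n - x) z := by
          rw [map_sub, RKHS.coe_sub, Pi.sub_apply]
        have h4 : L (u n - x) z = hardySeries (u n - x) z := congrFun (hΛ (u n - x)) z
        rw [h3, h4]
        exact norm_hardySeries_le hp _ z
    exact tendsto_nhds_unique h1 h2
  refine ⟨‖(⟨L, hcont⟩ : lp (fun _ : HardyBall p => ℂ) 1 →L[ℂ] DeBrangesRovnyak b)‖,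
    ContinuousLinearMap.opNorm_nonneg _, fun F hF hF1 => ?_⟩
  classical
  set f : HardyBall p := ⟨F, hF, hF1⟩ with hf
  have h1 : L (lp.single 1 f (1 : ℂ)) = F := by
    ext z
    change Λ _ z = _
    rw [hΛ', tsum_eq_single f]
    · simp [discExt_coe, hf]
    · intro g hg
      simp [lp.single_apply, hg]
  have h2 := (⟨L, hcont⟩ : lp (fun _ : HardyBall p => ℂ) 1 →L[ℂ] DeBrangesRovnyak b).le_opNorm
    (lp.single 1 f (1 : ℂ))
  rw [lp.norm_single (by simp), norm_one, mul_one] at h2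
  have h3 : (⟨L, hcont⟩ : lp (fun _ : HardyBall p => ℂ) 1 →L[ℂ] DeBrangesRovnyak b)
    (lp.single 1 f (1 : ℂ)) = F := h1
  rwa [h3] at h2

/-! ### The bounded form with symbol `φ` -/

/-- The sesquilinear form `⟨f, φ s⟩` is bounded by `C ‖f‖_p ‖s‖_2` on entire functions. -/
def HasPairingBound (p : ℝ) (φ : ℂ → ℂ) (C : ℝ) : Prop :=
  ∀ (f s : ℂ → ℂ) (S : ℝ), Differentiable ℂ f → Differentiable ℂ s →
    (∀ r, 0 < r → r < 1 → Real.circleAverage (fun z => ‖f z‖ ^ p) 0 r ≤ 1) →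
    (∀ r, 0 < r → r < 1 → circleNormSq s r ≤ S) →
    ∀ ρ : ℝ, 0 < ρ → ρ < 1 →
      ‖circlePairing (fun z => f (((1 / ρ) ^ 2 : ℝ) * z)) (fun z => φ z * s z) ρ‖ ≤ C * √S

theorem Differentiable.exists_norm_le {f : ℂ → ℂ} (hf : Differentiable ℂ f) (R : ℝ) :
    ∃ M, 0 ≤ M ∧ ∀ z, ‖z‖ ≤ R → ‖f z‖ ≤ M := by
  obtain ⟨M, hM⟩ := (isCompact_closedBall (0 : ℂ) R).exists_bound_of_continuousOn
    hf.continuous.continuousOn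
  exact ⟨max M 0, le_max_right _ _, fun z hz => (hM z (by simpa using hz)).trans (le_max_left _ _)⟩

/-- An entire `f` may be dilated by a factor above `1`, so a pairing on a large circle can be
computed on a fixed smaller one. This makes the limit `R → 1` explicit. -/
theorem circlePairing_eq_of_entire {f y : ℂ → ℂ} {r R S : ℝ} (hf : Differentiable ℂ f)
    (hr : 0 < r) (hrR : r ≤ R) (hRS : R < S) (hy : DifferentiableOn ℂ y (Metric.ball 0 S)) :
    circlePairing f y R = circlePairing (fun z => f (((R / r) ^ 2 : ℝ) * z)) y r := by
  have hR : 0 < R := hr.trans_le hrR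
  have h := circlePairing_eq_circlePairing_comp_mul (f := fun z => f (((R / r) ^ 2 : ℝ) * z)) hr hrR
    hRS (hf.comp (by fun_prop : Differentiable ℂ fun z : ℂ => (((R / r) ^ 2 : ℝ) : ℂ) * z)).differentiableOn hy
  rw [h]
  congr 1
  ext z
  congr 1
  have e : (R / r) ^ 2 * (r / R) ^ 2 = 1 := by field_simp
  rw [← mul_assoc, ← Complex.ofReal_mul, e, Complex.ofReal_one, one_mul]

/-- The pairing of an entire function with an analytic function of the disc, as a limit. -/
theorem tendsto_circlePairing_entire {f y : ℂ → ℂ} (hf : Differentiable ℂ f)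
    (hy : DifferentiableOn ℂ y (Metric.ball 0 1)) {ρ : ℝ} (hρ0 : 0 < ρ) (hρ1 : ρ < 1) :
    Tendsto (fun r => circlePairing f y r) (𝓝[<] 1)
      (𝓝 (circlePairing (fun z => f (((1 / ρ) ^ 2 : ℝ) * z)) y ρ)) := by
  obtain ⟨M, hM0, hM⟩ := hf.exists_norm_le (1 / ρ)
  have cy := hy.continuousOn_sphere hρ1
  obtain ⟨N, hN⟩ := (isCompact_sphere (0 : ℂ) ρ).exists_bound_of_continuousOn cy
  have h1 : Tendsto (fun r : ℝ => circlePairing (fun z => f (((r / ρ) ^ 2 : ℝ) * z)) y ρ) (𝓝[<] 1)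
      (𝓝 (circlePairing (fun z => f (((1 / ρ) ^ 2 : ℝ) * z)) y ρ)) := by
    refine tendsto_circleAverage_of_bounded (M := M * N) hρ0.le ?_ ?_ fun z _ => ?_
    · refine Eventually.of_forall fun r => ?_
      exact (hf.continuous.comp (by fun_prop)).continuousOn.mul
        (Complex.continuous_conj.comp_continuousOn cy)
    · filter_upwards [eventually_mem_Ioo_nhdsLT_one] with r hr z hz
      rw [norm_mul, RCLike.norm_conj]
      refine mul_le_mul (hM _ ?_) (hN z (by simpa using hz)) (norm_nonneg _) hM0
      rw [norm_mul, Complex.norm_real, Real.norm_of_nonneg (by positivity), hz, div_pow, pow_two ρ]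
      have : r ^ 2 / (ρ * ρ) * ρ = r ^ 2 / ρ := by field_simp
      rw [this]
      have : r ^ 2 ≤ 1 := pow_le_one₀ hr.1.le hr.2.le
      gcongr
    · have hc : Continuous fun r : ℝ => f (((r / ρ) ^ 2 : ℝ) * z) * conj (y z) :=
        (hf.continuous.comp (by fun_prop)).mul continuous_const
      exact (hc.tendsto 1).mono_left nhdsWithin_le_nhds
  refine h1.congr' ?_
  filter_upwards [self_mem_nhdsWithin, (eventually_gt_nhds hρ1).filter_mono nhdsWithin_le_nhds]
    with r hr1 hρr
  have hr0 : 0 < r := hρ0.trans hρr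
  exact (circlePairing_eq_of_entire hf hρ0 hρr.le hr1 hy).symm

/-- If `H^p` is contained in `H(b)` and `a` is outer, the form `⟨f, φ s⟩` with `a φ = b` is bounded
on `H^p × H²`. -/
theorem exists_hasPairingBound {b : hInftyUnitBall} {a : 𝔻 → ℂ} {p : ℝ} (hp : 1 ≤ p)
    (h : IsPythagoreanPair (discExt a) (discExt (b : 𝔻 → ℂ))) (ha : IsOuter a)
    (hsub : hardySpace p ⊆ dbrFunctions b) {φ : ℂ → ℂ} (hφ : DifferentiableOn ℂ φ (Metric.ball 0 1))
    (haφ : ∀ z, ‖z‖ < 1 → discExt a z * φ z = discExt (b : 𝔻 → ℂ) z) :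
    ∃ C, 0 ≤ C ∧ HasPairingBound p φ C := by
  obtain ⟨C, hC0, hC⟩ := exists_norm_le_of_hardySpace_subset hp hsub
  obtain ⟨g, hgd, hgb, hg1, hglim⟩ := ha.exists_tendsto_mul_one
  refine ⟨C, hC0, fun f s S hf hs hfp hsS ρ hρ0 hρ1 => ?_⟩
  set B := discExt (b : 𝔻 → ℂ) with hB
  set A := discExt a with hA
  set f₀ : 𝔻 → ℂ := fun z => f z with hf₀
  have hf₀e : ∀ z, ‖z‖ < 1 → discExt f₀ z = f z := fun z hz => by simp [discExt, hz, hf₀]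
  have hf₀a : IsAnalyticOnDisc f₀ :=
    hf.differentiableOn.congr fun z hz => hf₀e z (by simpa using hz)
  have hf₀m : ∀ r, 0 < r → r < 1 → hardyMean p f₀ r ≤ 1 := fun r hr0 hr1 => by
    refine le_trans (le_of_eq ?_) (hfp r hr0 hr1)
    exact circleAverage_congr_of_norm_eq hr0.le fun z hz => by rw [hf₀e z (by rwa [hz])]
  obtain ⟨F, hF⟩ := hsub (show f₀ ∈ hardySpace p from
    ⟨hf₀a, 1, by rintro _ ⟨r, hr, rfl⟩; exact hf₀m r hr.1 hr.2⟩)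
  have hF' : (F : 𝔻 → ℂ) = f₀ := hF
  have hFC : ‖F‖ ≤ C := hC F (by rw [hF']; exact hf₀a) (by rw [hF']; exact hf₀m)
  obtain ⟨K, hK0, hK⟩ := hs.exists_norm_le 1
  -- Test the functional on `y = g n * s`: its norm is governed by `A y = (A * g n) s`, which is
  -- dominated by `s` uniformly in `n`.
  have hstep : ∀ n, ‖circlePairing (fun z => f (((1 / ρ) ^ 2 : ℝ) * z))
      (fun z => B z * (g n z * s z)) ρ‖ ≤ C * √S := by
    intro n
    obtain ⟨M, hM⟩ := hgb n
    have hyd : DifferentiableOn ℂ (fun z => g n z * s z) (Metric.ball 0 1) :=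
      (hgd n).mul hs.differentiableOn
    have hM0 : 0 ≤ M := (norm_nonneg _).trans (hM 0 (by simp))
    have hlim := tendsto_circlePairing_entire hf (h.right.mul hyd) hρ0 hρ1
    refine (norm_le_of_tendsto_circlePairing h F (N := M * K) (S := S) hyd (fun z hz => ?_)
      (fun r hr0 hr1 => ?_) (hlim.congr' ?_)).trans ?_
    · rw [norm_mul]
      exact mul_le_mul (hM z hz) (hK z hz.le) (norm_nonneg _) hM0
    · refine (circleNormSq_mono hr0.le ((h.left.mul hyd).continuousOn_sphere hr1)
        hs.continuous.continuousOn fun z hz => ?_).trans (hsS r hr0 hr1)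
      rw [Pi.mul_apply, ← mul_assoc, norm_mul]
      exact mul_le_of_le_one_left (norm_nonneg _) (hg1 n z (by rwa [hz]))
    · filter_upwards [eventually_mem_Ioo_nhdsLT_one] with r hr
      refine circleAverage_congr_of_norm_eq hr.1.le fun z hz => ?_
      rw [hF', hf₀e z (by rw [hz]; exact hr.2)]
      rfl
    · gcongr
  have cφ := hφ.continuousOn_sphere hρ1
  have cs : ContinuousOn s (Metric.sphere 0 ρ) := hs.continuous.continuousOn
  have cf : ContinuousOn (fun z => f (((1 / ρ) ^ 2 : ℝ) * z)) (Metric.sphere 0 ρ) :=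
    (hf.continuous.comp (by fun_prop)).continuousOn
  obtain ⟨M, hM⟩ := (isCompact_sphere (0 : ℂ) ρ).exists_bound_of_continuousOn
    (cf.mul (Complex.continuous_conj.comp_continuousOn (cφ.mul cs)))
  -- Here `B * g n * s = (A * g n) φ s`, which is dominated by `φ s` and converges to it on the
  -- fixed circle.
  have hlim : Tendsto (fun n => circlePairing (fun z => f (((1 / ρ) ^ 2 : ℝ) * z))
      (fun z => B z * (g n z * s z)) ρ) atTop
      (𝓝 (circlePairing (fun z => f (((1 / ρ) ^ 2 : ℝ) * z)) (fun z => φ z * s z) ρ)) := by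
    refine tendsto_circleAverage_of_bounded (M := M) hρ0.le (Eventually.of_forall fun n => ?_)
      (Eventually.of_forall fun n z hz => ?_) fun z hz => ?_
    · exact cf.mul (Complex.continuous_conj.comp_continuousOn
        ((h.right.continuousOn_sphere hρ1).mul (((hgd n).continuousOn_sphere hρ1).mul cs)))
    · have h1 := hM z (by simpa using hz)
      have hz1 : ‖z‖ < 1 := by rwa [hz]
      refine le_trans ?_ h1
      have h2 : B z * (g n z * s z) = (A z * g n z) * (φ z * s z) := by
        rw [← haφ z hz1]; ring
      simp only [h2, Function.comp_apply, Pi.mul_apply]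
      rw [norm_mul, norm_mul, RCLike.norm_conj, RCLike.norm_conj, norm_mul (A z * g n z)]
      exact mul_le_mul_of_nonneg_left (mul_le_of_le_one_left (norm_nonneg _) (hg1 n z hz1))
        (norm_nonneg _)
    · have hz1 : ‖z‖ < 1 := by rwa [hz]
      refine Tendsto.const_mul _ ((Complex.continuous_conj.tendsto _).comp ?_)
      have h3 := (hglim z hz1).mul_const (φ z * s z)
      rw [one_mul] at h3
      refine h3.congr fun n => ?_
      simp only [← haφ z hz1]; ring
  exact le_of_tendsto hlim.norm (Eventually.of_forall hstep)

/-! ### Transfer to the dilations of the symbol -/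

/-- A circle average depending analytically on a parameter. -/
theorem differentiableOn_circleAverage_mul_comp {Q φ : ℂ → ℂ} {ρ : ℝ} (hρ : 0 < ρ)
    (hQ : ContinuousOn Q (Metric.sphere 0 ρ)) (hφ : DifferentiableOn ℂ φ (Metric.ball 0 1)) :
    DifferentiableOn ℂ (fun η => Real.circleAverage (fun z => Q z * φ (η * z)) 0 ρ)
      (Metric.ball 0 (1 / ρ)) := by
  intro η₀ hη₀
  have hη₀' : ‖η₀‖ < 1 / ρ := by simpa using hη₀
  -- For `‖η‖ < R` the points `η z` stay in the compact disc of radius `R ρ < 1`, on which `deriv φ`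
  -- is bounded.
  set R := (‖η₀‖ + 1 / ρ) / 2 with hR
  have hηR : ‖η₀‖ < R := by rw [hR]; linarith
  have hRρ : R * ρ < 1 := by
    have : R < 1 / ρ := by rw [hR]; linarith
    rwa [lt_div_iff₀ hρ] at this
  have hφ' : DifferentiableOn ℂ (deriv φ) (Metric.ball 0 1) := hφ.deriv Metric.isOpen_ball
  obtain ⟨M, hM⟩ := (isCompact_closedBall (0 : ℂ) (R * ρ)).exists_bound_of_continuousOn
    (hφ'.continuousOn.mono (Metric.closedBall_subset_ball hRρ))
  obtain ⟨N, hN⟩ := (isCompact_sphere (0 : ℂ) ρ).exists_bound_of_continuousOn hQ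
  have hn : ∀ θ : ℝ, ‖circleMap 0 ρ θ‖ = ρ := fun θ => by simp [abs_of_pos hρ]
  have hmem : ∀ η : ℂ, ‖η‖ < R → ∀ θ : ℝ, ‖η * circleMap 0 ρ θ‖ ≤ R * ρ := fun η hη θ => by
    rw [norm_mul, hn]
    gcongr
  have hcQ := continuous_comp_circleMap hρ.le hQ
  have hcφ : ∀ {ψ : ℂ → ℂ}, DifferentiableOn ℂ ψ (Metric.ball 0 1) → ∀ η : ℂ, ‖η‖ < R →
      Continuous fun θ => ψ (η * circleMap 0 ρ θ) := fun hψ η hη =>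
    hψ.continuousOn.comp_continuous (by fun_prop) fun θ => by
      simpa using (hmem η hη θ).trans_lt hRρ
  have key := intervalIntegral.hasDerivAt_integral_of_dominated_loc_of_deriv_le (𝕜 := ℂ)
    (μ := volume) (a := 0) (b := 2 * Real.pi) (x₀ := η₀) (s := Metric.ball 0 R)
    (F := fun η θ => Q (circleMap 0 ρ θ) * φ (η * circleMap 0 ρ θ))
    (F' := fun η θ => Q (circleMap 0 ρ θ) * (deriv φ (η * circleMap 0 ρ θ) * circleMap 0 ρ θ))
    (bound := fun _ => N * (M * ρ))
    (Metric.isOpen_ball.mem_nhds (by simpa using hηR))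
    (by
      filter_upwards [Metric.isOpen_ball.mem_nhds (show η₀ ∈ Metric.ball (0 : ℂ) R by simpa using hηR)]
        with η hη
      exact (hcQ.mul (hcφ hφ η (by simpa using hη))).aestronglyMeasurable)
    ((hcQ.mul (hcφ hφ η₀ hηR)).intervalIntegrable _ _)
    (hcQ.mul ((hcφ hφ' η₀ hηR).mul (continuous_circleMap 0 ρ))).aestronglyMeasurable
    (Eventually.of_forall fun θ _ η hη => by
      rw [norm_mul, norm_mul, hn]
      have h1 := hN _ (circleMap_mem_sphere 0 hρ.le θ)
      have h2 := hM (η * circleMap 0 ρ θ) (by simpa using hmem η (by simpa using hη) θ)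
      exact mul_le_mul h1 (mul_le_mul_of_nonneg_right h2 hρ.le) (by positivity)
        ((norm_nonneg _).trans h1))
    (by simp)
    (Eventually.of_forall fun θ _ η hη => by
      have h1 : HasDerivAt φ (deriv φ (η * circleMap 0 ρ θ)) (η * circleMap 0 ρ θ) :=
        (hφ.differentiableAt (Metric.isOpen_ball.mem_nhds (by
          simpa using (hmem η (by simpa using hη) θ).trans_lt hRρ))).hasDerivAt
      exact (h1.comp η (hasDerivAt_mul_const _)).const_mul _)
  exact (key.2.differentiableAt.const_smul (2 * Real.pi)⁻¹).differentiableWithinAt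

/-- A bound for the form with symbol `φ` is inherited by the dilations of `φ`. -/
theorem HasPairingBound.norm_circlePairing_dilation_le {p C : ℝ} {φ : ℂ → ℂ}
    (h : HasPairingBound p φ C) (hφ : DifferentiableOn ℂ φ (Metric.ball 0 1)) {t : ℝ} (ht0 : 0 < t)
    (ht1 : t < 1) {f s : ℂ → ℂ} {S : ℝ} (hf : Differentiable ℂ f) (hs : Differentiable ℂ s)
    (hfp : ∀ r, 0 < r → r < 1 → Real.circleAverage (fun z => ‖f z‖ ^ p) 0 r ≤ 1)
    (hsS : ∀ r, 0 < r → r < 1 → circleNormSq s r ≤ S) :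
    ‖circlePairing f (fun z => φ (t * z) * s z) 1‖ ≤ C * √S := by
  -- The value only needs to lie in `(0, 1)`, so that the disc of radius `1/ρ`, where `G` is
  -- analytic, contains the closed unit disc.
  set ρ : ℝ := 1 / 2 with hρ
  have hρ0 : 0 < ρ := by norm_num [hρ]
  have hρ1 : ρ < 1 := by norm_num [hρ]
  set Q : ℂ → ℂ := fun z => conj (f (((1 / ρ) ^ 2 : ℝ) * z)) * s z with hQ
  have cf : Continuous fun z => f (((1 / ρ) ^ 2 : ℝ) * z) := hf.continuous.comp (by fun_prop)
  have cQ : ContinuousOn Q (Metric.sphere 0 ρ) :=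
    ((Complex.continuous_conj.comp cf).mul hs.continuous).continuousOn
  -- For `|η| = 1` a rotation of `f` and `s` reduces `G η` to the form with symbol `φ`. The maximum
  -- principle carries the bound to `η = t`.
  set G : ℂ → ℂ := fun η => Real.circleAverage (fun z => Q z * φ (η * z)) 0 ρ with hG
  have hGd := differentiableOn_circleAverage_mul_comp hρ0 cQ hφ
  have hdisc : ∀ η : ℂ, ‖η‖ ≤ 1 → ContinuousOn (fun z => φ (η * z) * s z) (Metric.sphere 0 ρ) := by
    intro η hη
    refine (hφ.continuousOn.comp (by fun_prop) fun z hz => ?_).mul hs.continuous.continuousOn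
    rw [mem_ball_zero_iff, norm_mul, mem_sphere_zero_iff_norm.1 hz]
    nlinarith [norm_nonneg η]
  have hGpair : ∀ η : ℂ, ‖η‖ ≤ 1 → G η =
      conj (circlePairing (fun z => f (((1 / ρ) ^ 2 : ℝ) * z)) (fun z => φ (η * z) * s z) ρ) := by
    intro η hη
    rw [← circlePairing_conj_symm _ _ ρ hρ0.le (hdisc η hη) cf.continuousOn]
    refine circleAverage_congr_of_norm_eq hρ0.le fun z _ => ?_
    simp only [hQ]
    ring
  have hbd : ∀ η : ℂ, ‖η‖ = 1 → ‖G η‖ ≤ C * √S := by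
    intro η hη
    rw [hGpair η hη.le, RCLike.norm_conj]
    have hηη : conj η * η = 1 := by
      rw [mul_comm, Complex.mul_conj, Complex.normSq_eq_norm_sq, hη]; simp
    have hcη : ‖conj η‖ = 1 := by rw [RCLike.norm_conj, hη]
    have h1 := h (fun z => f (conj η * z)) (fun z => s (conj η * z)) S
      (hf.comp (by fun_prop : Differentiable ℂ fun z => conj η * z))
      (hs.comp (by fun_prop : Differentiable ℂ fun z => conj η * z))
      (fun r hr0 hr1 => by
        rw [circleAverage_comp_mul_left (fun z => ‖f z‖ ^ p) _ hcη]
        exact hfp r hr0 hr1)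
      (fun r hr0 hr1 => by
        unfold circleNormSq
        rw [circleAverage_comp_mul_left (fun z => ‖s z‖ ^ 2) _ hcη]
        exact hsS r hr0 hr1) ρ hρ0 hρ1
    refine le_trans (le_of_eq ?_) h1
    congr 1
    unfold circlePairing
    rw [← circleAverage_comp_mul_left (fun z => f (conj η * (((1 / ρ) ^ 2 : ℝ) * z)) *
      conj (φ z * s (conj η * z))) η hη]
    congr 1
    ext z
    have e1 : conj η * ((((1 / ρ) ^ 2 : ℝ) : ℂ) * (η * z)) = ((1 / ρ) ^ 2 : ℝ) * z := by
      linear_combination ((((1 / ρ) ^ 2 : ℝ) : ℂ) * z) * hηη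
    have e2 : conj η * (η * z) = z := by linear_combination z * hηη
    rw [e1, e2]
  have hmax : ‖G t‖ ≤ C * √S := by
    refine Complex.norm_le_of_forall_mem_frontier_norm_le (U := Metric.ball 0 1)
      Metric.isBounded_ball ?_ (fun η hη => ?_) ?_
    · refine DifferentiableOn.diffContOnCl ?_
      rw [closure_ball _ one_ne_zero]
      exact hGd.mono (Metric.closedBall_subset_ball (by norm_num [hρ]))
    · rw [frontier_ball _ one_ne_zero] at hη
      exact hbd η (by simpa using hη)
    · refine subset_closure ?_
      simpa [abs_of_pos ht0] using ht1
  have ht' : ‖(t : ℂ)‖ ≤ 1 := by simpa [abs_of_pos ht0] using ht1.le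
  rw [hGpair t ht', RCLike.norm_conj] at hmax
  refine le_trans (le_of_eq ?_) hmax
  congr 1
  -- The dilated symbol is analytic beyond the unit circle, so the pairing may be moved from radius
  -- `ρ` to radius `1`.
  have h1t : 1 < 1 / t := by rwa [lt_div_iff₀ ht0, one_mul]
  refine circlePairing_eq_of_entire hf hρ0 hρ1.le h1t ?_
  refine (hφ.comp (by fun_prop) fun z hz => ?_).mul hs.differentiableOn
  rw [mem_ball_zero_iff] at hz ⊢
  rw [norm_mul, Complex.norm_real, Real.norm_of_nonneg ht0.le]
  rw [lt_div_iff₀ ht0] at hz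
  linarith

/-! ### Polynomial approximation on the circle -/

/-- Trigonometric polynomials are uniformly dense in the continuous functions on the circle. -/
theorem exists_norm_sub_eval_add_conj_eval_le {u : ℂ → ℂ} (hu : ContinuousOn u (Metric.sphere 0 1))
    {ε : ℝ} (hε : 0 < ε) :
    ∃ P Q : Polynomial ℂ, ∀ z : ℂ, ‖z‖ = 1 → ‖u z - (P.eval z + conj (Q.eval z))‖ ≤ ε := by
  have : Fact (0 < 2 * Real.pi) := ⟨Real.two_pi_pos⟩
  have hspan : ∀ g ∈ Submodule.span ℂ (range (@fourier (2 * Real.pi))), ∃ P Q : Polynomial ℂ,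
      ∀ x : AddCircle (2 * Real.pi), g x = P.eval (x.toCircle : ℂ) +
        conj (Q.eval (x.toCircle : ℂ)) := by
    intro g hg
    induction hg using Submodule.span_induction with
    | mem g hg =>
      obtain ⟨n, rfl⟩ := hg
      obtain ⟨m, rfl | rfl⟩ := n.eq_nat_or_neg
      · exact ⟨Polynomial.X ^ m, 0, fun x => by simp [fourier_apply, AddCircle.toCircle_nsmul]⟩
      · refine ⟨0, Polynomial.X ^ m, fun x => ?_⟩
        rw [fourier_neg]
        simp [fourier_apply, AddCircle.toCircle_nsmul]
    | zero => exact ⟨0, 0, fun x => by simp⟩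
    | add g₁ g₂ _ _ h₁ h₂ =>
      obtain ⟨P₁, Q₁, h₁⟩ := h₁
      obtain ⟨P₂, Q₂, h₂⟩ := h₂
      refine ⟨P₁ + P₂, Q₁ + Q₂, fun x => ?_⟩
      simp only [ContinuousMap.add_apply, h₁, h₂, Polynomial.eval_add, map_add]
      ring
    | smul c g _ h =>
      obtain ⟨P, Q, h⟩ := h
      refine ⟨Polynomial.C c * P, Polynomial.C (conj c) * Q, fun x => ?_⟩
      simp only [ContinuousMap.smul_apply, h, smul_eq_mul, Polynomial.eval_mul, Polynomial.eval_C,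
        map_mul, Complex.conj_conj]
      ring
  set U : C(AddCircle (2 * Real.pi), ℂ) := ⟨fun x => u (x.toCircle : ℂ),
    hu.comp_continuous (continuous_subtype_val.comp AddCircle.continuous_toCircle)
      fun x => mem_sphere_zero_iff_norm.2 (Circle.norm_coe _)⟩ with hU
  have hcl : U ∈ closure (Submodule.span ℂ (range (@fourier (2 * Real.pi))) :
      Set C(AddCircle (2 * Real.pi), ℂ)) := by
    rw [← Submodule.topologicalClosure_coe, span_fourier_closure_eq_top]
    trivial
  obtain ⟨g, hg, hUg⟩ := Metric.mem_closure_iff.1 hcl ε hε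
  obtain ⟨P, Q, hPQ⟩ := hspan g hg
  refine ⟨P, Q, fun z hz => ?_⟩
  obtain ⟨θ, rfl⟩ := (Complex.norm_eq_one_iff z).1 hz
  have hθ : (AddCircle.toCircle (θ : AddCircle (2 * Real.pi)) : ℂ) =
      Complex.exp (θ * Complex.I) := by
    rw [AddCircle.toCircle_apply_mk, Circle.coe_exp]
    have : 2 * Real.pi / (2 * Real.pi) * θ = θ := by field_simp
    rw [this]
  have h1 := (ContinuousMap.dist_lt_iff hε).1 hUg (θ : AddCircle (2 * Real.pi))
  rw [hPQ, dist_eq_norm] at h1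
  simp only [hU, ContinuousMap.coe_mk, hθ] at h1
  exact h1.le

/-- On the circle `conj z = z⁻¹`, so a sufficiently high power of `z` clears the negative powers in
`conj Q`. -/
theorem exists_eval_eq_pow_mul_conj_eval (Q : Polynomial ℂ) :
    ∃ (N : ℕ) (R : Polynomial ℂ), ∀ z : ℂ, ‖z‖ = 1 → R.eval z = z ^ N * conj (Q.eval z) := by
  induction Q using Polynomial.induction_on' with
  | add Q₁ Q₂ h₁ h₂ =>
    obtain ⟨N₁, R₁, h₁⟩ := h₁
    obtain ⟨N₂, R₂, h₂⟩ := h₂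
    refine ⟨N₁ + N₂, Polynomial.X ^ N₂ * R₁ + Polynomial.X ^ N₁ * R₂, fun z hz => ?_⟩
    simp only [Polynomial.eval_add, Polynomial.eval_mul, Polynomial.eval_pow, Polynomial.eval_X,
      h₁ z hz, h₂ z hz, map_add]
    ring
  | monomial n c =>
    refine ⟨n, Polynomial.C (conj c), fun z hz => ?_⟩
    have hzz : z * conj z = 1 := by
      rw [Complex.mul_conj, Complex.normSq_eq_norm_sq, hz]; simp
    rw [Polynomial.eval_C, Polynomial.eval_monomial, map_mul, map_pow, mul_left_comm, ← mul_pow,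
      hzz, one_pow, mul_one]

/-- After multiplication by a power of `z`, a continuous function on the circle is uniformly close
to a polynomial. -/
theorem exists_norm_eval_sub_pow_mul_le {u : ℂ → ℂ} (hu : ContinuousOn u (Metric.sphere 0 1))
    {ε : ℝ} (hε : 0 < ε) :
    ∃ (N : ℕ) (P : Polynomial ℂ), ∀ z : ℂ, ‖z‖ = 1 → ‖P.eval z - z ^ N * u z‖ ≤ ε := by
  obtain ⟨P, Q, hPQ⟩ := exists_norm_sub_eval_add_conj_eval_le hu hε
  obtain ⟨N, R, hR⟩ := exists_eval_eq_pow_mul_conj_eval Q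
  refine ⟨N, Polynomial.X ^ N * P + R, fun z hz => ?_⟩
  rw [Polynomial.eval_add, Polynomial.eval_mul, Polynomial.eval_pow, Polynomial.eval_X, hR z hz,
    ← mul_add, ← mul_sub, norm_mul, norm_pow, hz, one_pow, one_mul, norm_sub_rev]
  exact hPQ z hz

/-- Real continuous functions on the circle are uniformly approximated by real parts of analytic
polynomials. -/
theorem exists_abs_re_eval_sub_le {u : ℂ → ℝ} (hu : ContinuousOn u (Metric.sphere 0 1))
    {ε : ℝ} (hε : 0 < ε) :
    ∃ P : Polynomial ℂ, ∀ z : ℂ, ‖z‖ = 1 → |(P.eval z).re - u z| ≤ ε := by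
  obtain ⟨P, Q, hPQ⟩ := exists_norm_sub_eval_add_conj_eval_le
    (Complex.continuous_ofReal.comp_continuousOn hu) hε
  -- `conj Q` and `Q` have the same real part.
  refine ⟨P + Q, fun z hz => ?_⟩
  refine le_trans ?_ (hPQ z hz)
  refine le_trans (le_of_eq ?_) (Complex.abs_re_le_norm _)
  rw [abs_sub_comm]
  simp

/-! ### From the bounded form to the means of `φ` -/

/-- A bounded form with symbol `φ` makes `φ(t ·)` a multiplier from `H^p` to `L²(𝕋)`, with a bound
independent of `t`. -/
theorem HasPairingBound.circleNormSq_mul_le {p C : ℝ} {φ : ℂ → ℂ} (hp : 0 ≤ p) (hC : 0 ≤ C)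
    (h : HasPairingBound p φ C) (hφ : DifferentiableOn ℂ φ (Metric.ball 0 1)) {t : ℝ} (ht0 : 0 < t)
    (ht1 : t < 1) {f : ℂ → ℂ} (hf : Differentiable ℂ f)
    (hfp : ∀ r, 0 < r → r < 1 → Real.circleAverage (fun z => ‖f z‖ ^ p) 0 r ≤ 1) :
    circleNormSq (fun z => φ (t * z) * f z) 1 ≤ C ^ 2 := by
  have cφ : ContinuousOn (fun z => φ (t * z)) (Metric.sphere 0 1) :=
    hφ.continuousOn.comp (by fun_prop) fun z hz => by
      rw [mem_ball_zero_iff, norm_mul, mem_sphere_zero_iff_norm.1 hz, Complex.norm_real,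
        Real.norm_of_nonneg ht0.le, mul_one]
      exact ht1
  set u : ℂ → ℂ := fun z => f z * conj (φ (t * z)) with hu
  have cu : ContinuousOn u (Metric.sphere 0 1) :=
    hf.continuous.continuousOn.mul (Complex.continuous_conj.comp_continuousOn cφ)
  have hnu : circleNormSq (fun z => φ (t * z) * f z) 1 = circleNormSq u 1 := by
    unfold circleNormSq
    simp [hu, mul_comm]
  rw [hnu]
  set X := circleNormSq u 1 with hX
  have hX0 : 0 ≤ X := circleNormSq_nonneg _ _
  obtain ⟨K, hK⟩ := (isCompact_sphere (0 : ℂ) 1).exists_bound_of_continuousOn cu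
  have hK0 : 0 ≤ K := (norm_nonneg _).trans (hK 1 (by simp))
  -- The ideal test function `s = u` is not analytic. Instead `s = P` is close to `z^N u` and `f` is
  -- replaced by `z^N f`, whose means are no larger. Letting `ε → 0` gives `X ≤ C √X`.
  have key : ∀ ε > 0, X ≤ ε * K + C * √(X + (2 * ε * K + ε ^ 2)) := by
    intro ε hε
    obtain ⟨N, P, hP⟩ := exists_norm_eval_sub_pow_mul_le cu hε
    have hPd := P.differentiable
    have hPc : ContinuousOn (fun z => P.eval z) (Metric.sphere 0 1) := hPd.continuous.continuousOn
    have hpz : Differentiable ℂ fun z : ℂ => z ^ N * f z := by fun_prop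
    have h1 := h.norm_circlePairing_dilation_le hφ ht0 ht1 (S := circleNormSq (fun z => P.eval z) 1)
      hpz hPd
      (fun r hr0 hr1 => by
        refine (circleAverage_mono_of_continuousOn hr0.le ?_ ?_ fun z hz => ?_).trans (hfp r hr0 hr1)
        · exact hpz.continuous.continuousOn.norm.rpow_const fun _ _ => Or.inr hp
        · exact hf.continuous.continuousOn.norm.rpow_const fun _ _ => Or.inr hp
        · refine Real.rpow_le_rpow (norm_nonneg _) ?_ hp
          rw [norm_mul, norm_pow, hz]
          exact mul_le_of_le_one_left (norm_nonneg _) (pow_le_one₀ hr0.le hr1.le))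
      (fun r hr0 hr1 => circleNormSq_le_circleNormSq hr0 hr1.le one_lt_two hPd.differentiableOn)
    have h2 : circleNormSq (fun z => P.eval z) 1 ≤ X + (2 * ε * K + ε ^ 2) := by
      have e1 : X + (2 * ε * K + ε ^ 2) =
          Real.circleAverage (fun z => ‖u z‖ ^ 2 + (2 * ε * K + ε ^ 2)) 0 1 := by
        rw [Real.circleAverage_fun_add (f₁ := fun z => ‖u z‖ ^ 2) ((cu.norm.pow 2).circleIntegrable zero_le_one)
          (circleIntegrable_const _ _ _), Real.circleAverage_const]
        rfl
      rw [e1]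
      refine circleAverage_mono_of_continuousOn zero_le_one (hPc.norm.pow 2)
        ((cu.norm.pow 2).add continuousOn_const) fun z hz => ?_
      have e2 : ‖P.eval z‖ ≤ ‖u z‖ + ε := by
        have e3 := norm_le_norm_add_norm_sub' (P.eval z) (z ^ N * u z)
        rw [norm_mul, norm_pow, hz, one_pow, one_mul] at e3
        linarith [hP z hz]
      have e4 := hK z (by simpa using hz)
      calc ‖P.eval z‖ ^ 2 ≤ (‖u z‖ + ε) ^ 2 := by gcongr
        _ = ‖u z‖ ^ 2 + (2 * ε * ‖u z‖ + ε ^ 2) := by ring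
        _ ≤ _ := by gcongr
    have h3 : (X : ℂ) = circlePairing (fun z => z ^ N * f z) (fun z => φ (t * z) * P.eval z) 1 -
        circlePairing (fun z => z ^ N * u z) (fun z => P.eval z - z ^ N * u z) 1 := by
      have cz : ContinuousOn (fun z : ℂ => z ^ N * u z) (Metric.sphere 0 1) :=
        (by fun_prop : Continuous fun z : ℂ => z ^ N).continuousOn.mul cu
      have e5 : circlePairing (fun z => z ^ N * f z) (fun z => φ (t * z) * P.eval z) 1 =
          circlePairing (fun z => z ^ N * u z) (fun z => P.eval z) 1 := by
        unfold circlePairing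
        congr 1
        ext z
        simp only [hu, map_mul]
        ring
      rw [e5, circlePairing_sub_right zero_le_one hPc cz cz, sub_sub_cancel,
        circlePairing_self _ zero_le_one cz]
      congr 1
      refine circleAverage_congr_of_norm_eq zero_le_one fun z hz => ?_
      have e6 : ‖z ^ N * u z‖ = ‖u z‖ := by rw [norm_mul, norm_pow, hz, one_pow, one_mul]
      simp only [e6]
    have h4 : ‖circlePairing (fun z => z ^ N * u z) (fun z => P.eval z - z ^ N * u z) 1‖ ≤ ε * K := by
      have cz : ContinuousOn (fun z : ℂ => z ^ N * u z) (Metric.sphere 0 1) :=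
        (by fun_prop : Continuous fun z : ℂ => z ^ N).continuousOn.mul cu
      refine (norm_circleAverage_le _ _).trans ?_
      refine Real.circleAverage_mono_on_of_le_circle
        ((cz.mul (Complex.continuous_conj.comp_continuousOn (hPc.sub cz))).norm.circleIntegrable
          zero_le_one) fun z hz => ?_
      have hz1 : ‖z‖ = 1 := by simpa using hz
      rw [norm_mul, RCLike.norm_conj, norm_mul, norm_pow, hz1, one_pow, one_mul, mul_comm]
      exact mul_le_mul (hP z hz1) (hK z (by simpa using hz1)) (norm_nonneg _) hε.le
    have h5 : X = ‖(X : ℂ)‖ := by rw [Complex.norm_real, Real.norm_of_nonneg hX0]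
    rw [h5, h3]
    refine (norm_sub_le _ _).trans ?_
    rw [add_comm]
    refine add_le_add h4 (h1.trans ?_)
    rw [← h3, ← h5]
    exact mul_le_mul_of_nonneg_left (Real.sqrt_le_sqrt h2) hC
  have hlim : Tendsto (fun ε : ℝ => ε * K + C * √(X + (2 * ε * K + ε ^ 2))) (𝓝[>] 0)
      (𝓝 (0 * K + C * √(X + (2 * 0 * K + 0 ^ 2)))) := by
    have : Continuous fun ε : ℝ => ε * K + C * √(X + (2 * ε * K + ε ^ 2)) := by fun_prop
    exact (this.tendsto 0).mono_left nhdsWithin_le_nhds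
  have hfin : X ≤ C * √X := by
    have := ge_of_tendsto hlim (eventually_mem_nhdsWithin.mono fun ε hε => key ε hε)
    simpa using this
  have hsq := Real.mul_self_sqrt hX0
  rcases (Real.sqrt_nonneg X).eq_or_lt with h0 | h0
  · rw [← hsq, ← h0, mul_zero]; positivity
  · have h6 : √X ≤ C := by
      refine le_of_mul_le_mul_right ?_ h0
      rwa [hsq]
    nlinarith

/-- Quadratic means are dominated by means of order `p > 2`. -/
theorem circleNormSq_le_rpow {p : ℝ} (hp : 2 < p) {f : ℂ → ℂ} {r : ℝ} (hr : 0 ≤ r)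
    (hf : ContinuousOn f (Metric.sphere 0 r)) :
    circleNormSq f r ≤ Real.circleAverage (fun z => ‖f z‖ ^ p) 0 r ^ (2 / p) := by
  have hp0 : 0 < p := by linarith
  have hpq : (p / 2).HolderConjugate (p / (p - 2)) := by
    rw [Real.holderConjugate_iff]
    have : p - 2 ≠ 0 := by linarith
    refine ⟨by linarith, ?_⟩
    field_simp
    ring
  have h := circleAverage_mul_le_Lp_mul_Lq hpq (f := fun z => ‖f z‖ ^ 2) hr (hf.norm.pow 2)
    (continuousOn_const (c := (1 : ℝ))) (fun z => by positivity) (fun _ => zero_le_one)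
  simp only [mul_one, Real.one_rpow, Real.circleAverage_const] at h
  have e1 : ∀ z, (‖f z‖ ^ 2) ^ (p / 2) = ‖f z‖ ^ p := fun z => by
    rw [← Real.rpow_natCast, ← Real.rpow_mul (norm_nonneg _)]
    congr 1
    push_cast
    ring
  simp only [e1, one_div, inv_div] at h
  exact h

/-- The symbol of a bounded form belongs to `H^q`, `q = 2p/(p-2)`: its means are bounded. -/
theorem HasPairingBound.circleAverage_rpow_le {p C : ℝ} {φ : ℂ → ℂ} (hp : 2 < p) (hC : 0 ≤ C)
    (h : HasPairingBound p φ C) (hφ : DifferentiableOn ℂ φ (Metric.ball 0 1)) {t : ℝ} (ht0 : 0 < t)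
    (ht1 : t < 1) :
    Real.circleAverage (fun z => ‖φ z‖ ^ (2 * p / (p - 2))) 0 t ≤
      (Real.exp 4 * (C ^ 2 + 1)) ^ (p / (p - 2)) := by
  have hp0 : 0 < p := by linarith
  have hp2 : 0 < p - 2 := by linarith
  have cφ : ContinuousOn (fun z => φ (t * z)) (Metric.sphere 0 1) :=
    hφ.continuousOn.comp (by fun_prop) fun z hz => by
      rw [mem_ball_zero_iff, norm_mul, mem_sphere_zero_iff_norm.1 hz, Complex.norm_real,
        Real.norm_of_nonneg ht0.le, mul_one]
      exact ht1
  -- The summand `1` keeps `log W` continuous at the zeros of the symbol.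
  set W : ℂ → ℝ := fun z => 1 + ‖φ (t * z)‖ ^ 2 with hW
  have hW1 : ∀ z, 1 ≤ W z := fun z => le_add_of_nonneg_right (by positivity)
  have hW0 : ∀ z, 0 < W z := fun z => one_pos.trans_le (hW1 z)
  have cW : ContinuousOn W (Metric.sphere 0 1) := continuousOn_const.add (cφ.norm.pow 2)
  have cWr : ∀ s : ℝ, ContinuousOn (fun z => W z ^ s) (Metric.sphere 0 1) := fun s =>
    cW.rpow_const fun z _ => Or.inl (hW0 z).ne'
  set I := Real.circleAverage (fun z => W z ^ (p / (p - 2))) 0 1 with hI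
  have hI1 : 1 ≤ I := by
    have h1 := circleAverage_mono_of_continuousOn (f := fun _ => (1 : ℝ))
      zero_le_one continuousOn_const (cWr (p / (p - 2)))
      fun z _ => Real.one_le_rpow (hW1 z) (by positivity)
    rwa [Real.circleAverage_const] at h1
  have hI0 : 0 < I := by linarith
  -- The extremal case of Hölder is `|f| = W^{1/(p-2)}`, for which `|f|^p` and `W |f|²` both equal
  -- `W^{p/(p-2)}`. Approximating `log |f|` within `1` by the real part of a polynomial makes `f`
  -- entire and costs the factors `e^p` and `e^{-2}`.
  obtain ⟨Q, hQ⟩ := exists_abs_re_eval_sub_le (u := fun z => 1 / (p - 2) * Real.log (W z))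
    (continuousOn_const.mul (cW.log fun z _ => (hW0 z).ne')) one_pos
  have hQd := Q.differentiable
  set f : ℂ → ℂ := fun z => Complex.exp (Q.eval z) with hf
  have hfd : Differentiable ℂ f := hQd.cexp
  have hWlog : ∀ z (s : ℝ), W z ^ s = Real.exp (s * Real.log (W z)) := fun z s => by
    rw [Real.rpow_def_of_pos (hW0 z), mul_comm]
  have hfp : ∀ z, ‖z‖ = 1 → ‖f z‖ ^ p ≤ Real.exp p * W z ^ (p / (p - 2)) := by
    intro z hz
    have h1 := (abs_le.1 (hQ z hz)).2
    rw [hf, Complex.norm_exp, ← Real.exp_mul, hWlog, ← Real.exp_add]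
    refine Real.exp_le_exp.2 ?_
    have h2 : p / (p - 2) * Real.log (W z) = 1 / (p - 2) * Real.log (W z) * p := by ring
    rw [h2]
    nlinarith
  have hf2 : ∀ z, ‖z‖ = 1 → Real.exp (-2) * W z ^ (p / (p - 2)) ≤ W z * ‖f z‖ ^ 2 := by
    intro z hz
    have h1 := (abs_le.1 (hQ z hz)).1
    have h2 : W z = Real.exp (Real.log (W z)) := (Real.exp_log (hW0 z)).symm
    rw [hf, Complex.norm_exp, ← Real.exp_nat_mul, hWlog, ← Real.exp_add]
    conv_rhs => rw [h2, ← Real.exp_add]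
    refine Real.exp_le_exp.2 ?_
    have h3 : p / (p - 2) * Real.log (W z) =
        Real.log (W z) + 2 * (1 / (p - 2) * Real.log (W z)) := by
      field_simp
      ring
    rw [h3]
    push_cast
    linarith
  set m := Real.circleAverage (fun z => ‖f z‖ ^ p) 0 1 with hm
  have cfp : ∀ r, ContinuousOn (fun z => ‖f z‖ ^ p) (Metric.sphere 0 r) := fun r =>
    hfd.continuous.continuousOn.norm.rpow_const fun _ _ => Or.inr hp0.le
  have hmI : m ≤ Real.exp p * I := by
    have h1 : Real.exp p * I =
        Real.circleAverage (fun z => Real.exp p * W z ^ (p / (p - 2))) 0 1 :=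
      (Real.circleAverage_fun_smul (a := Real.exp p)).symm
    rw [h1]
    exact circleAverage_mono_of_continuousOn zero_le_one (cfp 1)
      (continuousOn_const.mul (cWr _)) hfp
  have hmr : ∀ r, 0 < r → r ≤ 1 → Real.circleAverage (fun z => ‖f z‖ ^ p) 0 r ≤ m := by
    intro r hr0 hr1
    -- `|f|^p` is the square modulus of this entire function, so monotonicity of quadratic means
    -- suffices for order `p`.
    have hE : Differentiable ℂ fun z => Complex.exp ((p / 2 : ℝ) * Q.eval z) :=
      (hQd.const_mul _).cexp
    have h1 := circleNormSq_le_circleNormSq hr0 hr1 one_lt_two hE.differentiableOn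
    have h2 : ∀ z, ‖Complex.exp ((p / 2 : ℝ) * Q.eval z)‖ ^ 2 = ‖f z‖ ^ p := fun z => by
      rw [hf, Complex.norm_exp, Complex.norm_exp, ← Real.exp_mul, ← Real.exp_nat_mul,
        Complex.re_ofReal_mul]
      congr 1
      push_cast
      ring
    unfold circleNormSq at h1
    simpa only [h2] using h1
  have hm0 : 0 < m := by
    obtain ⟨z₀, hz₀, hmin⟩ := (isCompact_sphere (0 : ℂ) 1).exists_isMinOn ⟨1, by simp⟩ (cfp 1)
    have h1 : 0 < ‖f z₀‖ ^ p := Real.rpow_pos_of_pos (norm_pos_iff.2 (Complex.exp_ne_zero _)) _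
    have h2 := circleAverage_mono_of_continuousOn (f := fun _ => ‖f z₀‖ ^ p) zero_le_one
      continuousOn_const (cfp 1) fun z hz => hmin (by simpa using hz)
    rw [Real.circleAverage_const] at h2
    linarith
  set κ : ℝ := m ^ (-1 / p) with hκ
  have hκ0 : 0 < κ := Real.rpow_pos_of_pos hm0 _
  have hκp : κ ^ p = m⁻¹ := by
    rw [hκ, ← Real.rpow_mul hm0.le, div_mul_cancel₀ _ hp0.ne', Real.rpow_neg_one]
  have hκ2 : κ ^ 2 = (m ^ (2 / p))⁻¹ := by
    rw [hκ, ← Real.rpow_natCast, ← Real.rpow_mul hm0.le, ← Real.rpow_neg hm0.le]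
    congr 1
    push_cast
    ring
  have hmul := h.circleNormSq_mul_le hp0.le hC hφ ht0 ht1 (f := fun z => (κ : ℂ) * f z)
    (hfd.const_mul _) fun r hr0 hr1 => by
      have h1 : Real.circleAverage (fun z => ‖(κ : ℂ) * f z‖ ^ p) 0 r =
          κ ^ p * Real.circleAverage (fun z => ‖f z‖ ^ p) 0 r := by
        rw [← smul_eq_mul (κ ^ p), ← Real.circleAverage_fun_smul]
        congr 1
        ext z
        rw [norm_mul, Complex.norm_real, Real.norm_of_nonneg hκ0.le,
          Real.mul_rpow hκ0.le (norm_nonneg _), smul_eq_mul]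
      rw [h1, hκp, inv_mul_le_iff₀ hm0, mul_one]
      exact hmr r hr0 hr1.le
  have hmul' : circleNormSq (fun z => φ (t * z) * f z) 1 ≤ C ^ 2 * m ^ (2 / p) := by
    have h1 : circleNormSq (fun z => φ (t * z) * ((κ : ℂ) * f z)) 1 =
        κ ^ 2 * circleNormSq (fun z => φ (t * z) * f z) 1 := by
      unfold circleNormSq
      rw [← smul_eq_mul (κ ^ 2), ← Real.circleAverage_fun_smul]
      congr 1
      ext z
      rw [norm_mul, norm_mul, norm_mul, Complex.norm_real, Real.norm_of_nonneg hκ0.le, smul_eq_mul]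
      ring
    rw [h1, hκ2, inv_mul_le_iff₀ (Real.rpow_pos_of_pos hm0 _)] at hmul
    linarith
  have hone := circleNormSq_le_rpow hp zero_le_one (f := f) hfd.continuous.continuousOn
  -- The two summands of `W` contribute separately: `C²` from the multiplier bound and `1` from
  -- comparing means of orders `2` and `p`.
  have hsum : Real.circleAverage (fun z => W z * ‖f z‖ ^ 2) 0 1 ≤ (C ^ 2 + 1) * m ^ (2 / p) := by
    have h1 : Real.circleAverage (fun z => W z * ‖f z‖ ^ 2) 0 1 =
        circleNormSq f 1 + circleNormSq (fun z => φ (t * z) * f z) 1 := by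
      unfold circleNormSq
      rw [← Real.circleAverage_fun_add (f₁ := fun z => ‖f z‖ ^ 2)
        (f₂ := fun z => ‖φ (t * z) * f z‖ ^ 2)
        ((hfd.continuous.continuousOn.norm.pow 2).circleIntegrable zero_le_one)
        (((cφ.mul hfd.continuous.continuousOn).norm.pow 2).circleIntegrable zero_le_one)]
      congr 1
      ext z
      simp only [hW, norm_mul]
      ring
    rw [h1]
    linarith
  have hlow : Real.exp (-2) * I ≤ Real.circleAverage (fun z => W z * ‖f z‖ ^ 2) 0 1 := by
    have h1 : Real.exp (-2) * I =
        Real.circleAverage (fun z => Real.exp (-2) * W z ^ (p / (p - 2))) 0 1 :=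
      (Real.circleAverage_fun_smul (a := Real.exp (-2))).symm
    rw [h1]
    exact circleAverage_mono_of_continuousOn zero_le_one (continuousOn_const.mul (cWr _))
      (cW.mul (hfd.continuous.continuousOn.norm.pow 2)) hf2
  have hmI' : m ^ (2 / p) ≤ Real.exp 2 * I ^ (2 / p) := by
    refine (Real.rpow_le_rpow hm0.le hmI (by positivity)).trans (le_of_eq ?_)
    rw [Real.mul_rpow (Real.exp_pos _).le hI0.le, ← Real.exp_mul]
    congr 2
    field_simp
  -- Divide by `I^(2/p) > 0`. One factor `e²` comes from the lower bound for `W |f|²`, the other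
  -- from `(e^p)^(2/p)`.
  have hbound : I ^ ((p - 2) / p) ≤ Real.exp 4 * (C ^ 2 + 1) := by
    have h1 : Real.exp (-2) * I ≤ (C ^ 2 + 1) * (Real.exp 2 * I ^ (2 / p)) :=
      (hlow.trans hsum).trans (mul_le_mul_of_nonneg_left hmI' (by positivity))
    have h2 : I = I ^ ((p - 2) / p) * I ^ (2 / p) := by
      rw [← Real.rpow_add hI0]
      have : (p - 2) / p + 2 / p = 1 := by field_simp; ring
      rw [this, Real.rpow_one]
    have h3 : 0 < I ^ (2 / p) := Real.rpow_pos_of_pos hI0 _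
    have h4 : Real.exp 4 = Real.exp 2 * Real.exp 2 := by rw [← Real.exp_add]; norm_num
    have h5 : Real.exp 2 * Real.exp (-2) = 1 := by rw [← Real.exp_add]; norm_num
    refine le_of_mul_le_mul_right ?_ h3
    rw [← h2]
    calc I = Real.exp 2 * (Real.exp (-2) * I) := by rw [← mul_assoc, h5, one_mul]
      _ ≤ Real.exp 2 * ((C ^ 2 + 1) * (Real.exp 2 * I ^ (2 / p))) := by gcongr
      _ = Real.exp 4 * (C ^ 2 + 1) * I ^ (2 / p) := by rw [h4]; ring
  have hIfin : I ≤ (Real.exp 4 * (C ^ 2 + 1)) ^ (p / (p - 2)) := by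
    have h1 := Real.rpow_le_rpow (Real.rpow_nonneg hI0.le _) hbound
      (show 0 ≤ p / (p - 2) by positivity)
    rw [← Real.rpow_mul hI0.le] at h1
    have : (p - 2) / p * (p / (p - 2)) = 1 := by field_simp
    rwa [this, Real.rpow_one] at h1
  refine le_trans ?_ hIfin
  have h1 : Real.circleAverage (fun z => ‖φ z‖ ^ (2 * p / (p - 2))) 0 t =
      Real.circleAverage (fun z => ‖φ (t * z)‖ ^ (2 * p / (p - 2))) 0 1 := by
    rw [circleAverage_comp_mul_real (fun z => ‖φ z‖ ^ (2 * p / (p - 2))) t 1, mul_one]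
  rw [h1]
  refine circleAverage_mono_of_continuousOn zero_le_one
    (cφ.norm.rpow_const fun _ _ => Or.inr (by positivity)) (cWr _) fun z _ => ?_
  have h2 : ‖φ (t * z)‖ ^ (2 * p / (p - 2)) = (‖φ (t * z)‖ ^ 2) ^ (p / (p - 2)) := by
    rw [← Real.rpow_natCast, ← Real.rpow_mul (norm_nonneg _)]
    congr 1
    push_cast
    ring
  rw [h2]
  refine Real.rpow_le_rpow (by positivity) ?_ (by positivity)
  simp only [hW]
  linarith

/-! ### The criterion `φ ∈ H^q` -/

theorem norm_discExt_le_one {f : 𝔻 → ℂ} (hf : f ∈ hInftyUnitBall) (z : ℂ) : ‖discExt f z‖ ≤ 1 := by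
  unfold discExt
  split_ifs with h
  · exact hf.2 _
  · simp

theorem IsPythagoreanMate.isPythagoreanPair {a : 𝔻 → ℂ} {b : hInftyUnitBall}
    (h : IsPythagoreanMate a b) : IsPythagoreanPair (discExt a) (discExt (b : 𝔻 → ℂ)) where
  left := h.1.1
  right := b.2.1
  norm_left_le := norm_discExt_le_one h.1
  norm_right_le := norm_discExt_le_one b.2
  radial := h.2.2

theorem IsOuter.ne_zero {f : 𝔻 → ℂ} (hf : IsOuter f) (z : 𝔻) : f z ≠ 0 := by
  obtain ⟨c, u, hc, -, h⟩ := hf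
  rw [h z]
  refine mul_ne_zero ?_ (Complex.exp_ne_zero _)
  rw [← norm_ne_zero_iff, hc]
  exact one_ne_zero

theorem IsOuter.discExt_mul_discExt_div {a : 𝔻 → ℂ} (ha : IsOuter a) (b : 𝔻 → ℂ) {z : ℂ}
    (hz : ‖z‖ < 1) : discExt a z * discExt (fun z => b z / a z) z = discExt b z := by
  simp only [discExt, hz, dif_pos]
  exact mul_div_cancel₀ _ (ha.ne_zero _)

theorem IsOuter.isAnalyticOnDisc_div {a b : 𝔻 → ℂ} (ha : IsOuter a) (had : IsAnalyticOnDisc a)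
    (hb : IsAnalyticOnDisc b) : IsAnalyticOnDisc fun z => b z / a z := by
  refine (DifferentiableOn.div hb had fun z hz => ?_).congr fun z hz => ?_
  · rw [mem_ball_zero_iff] at hz
    simp only [discExt, hz, dif_pos]
    exact ha.ne_zero _
  · rw [mem_ball_zero_iff] at hz
    simp [discExt, hz]

/-- Hölder for `|f|²` and `|g|²` with conjugate exponents `p/2` and `p/(p-2)`; doubling the latter
produces the exponent `2p/(p-2)`. -/
theorem circleNormSq_mul_le {p : ℝ} (hp : 2 < p) {f g : ℂ → ℂ} {r : ℝ} (hr : 0 ≤ r)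
    (hf : ContinuousOn f (Metric.sphere 0 r)) (hg : ContinuousOn g (Metric.sphere 0 r)) :
    circleNormSq (fun z => f z * g z) r ≤
      Real.circleAverage (fun z => ‖f z‖ ^ p) 0 r ^ (2 / p) *
        Real.circleAverage (fun z => ‖g z‖ ^ (2 * p / (p - 2))) 0 r ^ ((p - 2) / p) := by
  have hp2 : p - 2 ≠ 0 := by linarith
  have hp0 : 0 < p := by linarith
  have hpq : (p / 2).HolderConjugate (p / (p - 2)) := by
    rw [Real.holderConjugate_iff]
    refine ⟨by linarith, ?_⟩
    field_simp
    ring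
  have h := circleAverage_mul_le_Lp_mul_Lq hpq (f := fun z => ‖f z‖ ^ 2) (g := fun z => ‖g z‖ ^ 2)
    hr (hf.norm.pow 2) (hg.norm.pow 2) (fun z => by positivity) (fun z => by positivity)
  have e : ∀ (x : ℂ) (s : ℝ), (‖x‖ ^ 2) ^ s = ‖x‖ ^ (2 * s) := fun x s => by
    rw [← Real.rpow_natCast, ← Real.rpow_mul (norm_nonneg _), Nat.cast_ofNat]
  have e1 : 2 * (p / 2) = p := by ring
  have e2 : 2 * (p / (p - 2)) = 2 * p / (p - 2) := by ring
  simp only [e, e1, e2, one_div, inv_div, ← mul_pow, ← norm_mul] at h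
  exact h

theorem exists_hardyMean_le {p : ℝ} {f : 𝔻 → ℂ} (hf : f ∈ hardySpace p) :
    ∃ M, ∀ r, 0 < r → r < 1 → hardyMean p f r ≤ M := by
  obtain ⟨M, hM⟩ := hf.2
  exact ⟨M, fun r hr0 hr1 => hM ⟨r, ⟨hr0, hr1⟩, rfl⟩⟩

theorem hardyMean_nonneg (p : ℝ) (f : 𝔻 → ℂ) (r : ℝ) : 0 ≤ hardyMean p f r :=
  Real.circleAverage_nonneg_of_nonneg fun _ _ => by positivity

theorem hardySpace_subset_dbrFunctions {b : hInftyUnitBall} {a : 𝔻 → ℂ}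
    (ha : IsPythagoreanMate a b) {p : ℝ} (hp : 2 < p)
    (hφ : (fun z => (b : 𝔻 → ℂ) z / a z) ∈ hardySpace (2 * p / (p - 2))) :
    hardySpace p ⊆ dbrFunctions b := by
  intro f hf
  obtain ⟨M, hM⟩ := exists_hardyMean_le hf
  obtain ⟨N, hN⟩ := exists_hardyMean_le hφ
  have hM0 : 0 ≤ M := (hardyMean_nonneg p f (1 / 2)).trans (hM _ (by norm_num) (by norm_num))
  have hp2 : 0 < p - 2 := by linarith
  have hp0 : 0 < p := by linarith
  refine mem_dbrFunctions_of_circleNormSq_le ha.isPythagoreanPair hf.1 hφ.1.continuousOn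
    (fun z hz => ha.2.1.discExt_mul_discExt_div _ hz)
    (C := M ^ (2 / p) + M ^ (2 / p) * N ^ ((p - 2) / p)) fun r hr0 hr1 => ?_
  have cf := hf.1.continuousOn_sphere hr1
  have cφ := hφ.1.continuousOn_sphere hr1
  have h1 : Real.circleAverage (fun z => ‖discExt f z‖ ^ p) 0 r ^ (2 / p) ≤ M ^ (2 / p) :=
    Real.rpow_le_rpow (hardyMean_nonneg p f r) (hM r hr0 hr1) (by positivity)
  refine add_le_add ((circleNormSq_le_rpow hp hr0.le cf).trans h1)
    ((circleNormSq_mul_le hp hr0.le cf cφ).trans (mul_le_mul h1 ?_ ?_ (by positivity)))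
  · exact Real.rpow_le_rpow (hardyMean_nonneg _ _ r) (hN r hr0 hr1) (by positivity)
  · exact Real.rpow_nonneg (hardyMean_nonneg _ _ r) _

theorem div_mem_hardySpace {b : hInftyUnitBall} {a : 𝔻 → ℂ} (ha : IsPythagoreanMate a b) {p : ℝ}
    (hp : 2 < p) (hsub : hardySpace p ⊆ dbrFunctions b) :
    (fun z => (b : 𝔻 → ℂ) z / a z) ∈ hardySpace (2 * p / (p - 2)) := by
  have hφ := ha.2.1.isAnalyticOnDisc_div ha.1.1 b.2.1
  obtain ⟨C, hC0, hC⟩ := exists_hasPairingBound (by linarith) ha.isPythagoreanPair ha.2.1 hsub hφ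
    fun z hz => ha.2.1.discExt_mul_discExt_div _ hz
  refine ⟨hφ, (Real.exp 4 * (C ^ 2 + 1)) ^ (p / (p - 2)), ?_⟩
  rintro _ ⟨t, ⟨ht0, ht1⟩, rfl⟩
  exact hC.circleAverage_rpow_le hp hC0 hφ ht0 ht1

/-! ### Monomials and failure of compactness -/

theorem discExt_coe_pow (n : ℕ) {z : ℂ} (hz : ‖z‖ < 1) :
    discExt (fun w => (w : ℂ) ^ n) z = z ^ n := by
  simp [discExt, hz]

theorem hardyMean_coe_pow_le {p : ℝ} (hp : 0 ≤ p) (n : ℕ) {r : ℝ} (hr0 : 0 < r) (hr1 : r < 1) :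
    hardyMean p (fun w => (w : ℂ) ^ n) r ≤ 1 := by
  have h : ∀ z ∈ Metric.sphere (0 : ℂ) |r|,
      ‖discExt (fun w => (w : ℂ) ^ n) z‖ ^ p = (r ^ n) ^ p := fun z hz => by
    rw [mem_sphere_zero_iff_norm, abs_of_pos hr0] at hz
    rw [discExt_coe_pow n (hz.trans_lt hr1), norm_pow, hz]
  rw [hardyMean, Real.circleAverage_congr_sphere h, Real.circleAverage_const]
  exact Real.rpow_le_one (by positivity) (pow_le_one₀ hr0.le hr1.le) hp

theorem coe_pow_mem_hardySpace {p : ℝ} (hp : 0 ≤ p) (n : ℕ) :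
    (fun w : 𝔻 => (w : ℂ) ^ n) ∈ hardySpace p := by
  refine ⟨?_, 1, ?_⟩
  · refine (differentiable_pow n).differentiableOn.congr fun z hz => ?_
    exact discExt_coe_pow n (mem_ball_zero_iff.1 hz)
  · rintro _ ⟨r, ⟨hr0, hr1⟩, rfl⟩
    exact hardyMean_coe_pow_le hp n hr0 hr1

theorem hardyNorm_coe_pow_le {p : ℝ} (hp : 0 ≤ p) (n : ℕ) :
    hardyNorm p (fun w => (w : ℂ) ^ n) ≤ 1 := by
  refine Real.rpow_le_one (Real.sSup_nonneg ?_) (csSup_le ?_ ?_) (by positivity)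
  · rintro _ ⟨r, -, rfl⟩
    exact hardyMean_nonneg _ _ _
  · exact (nonempty_Ioo.2 one_pos).image _
  · rintro _ ⟨r, ⟨hr0, hr1⟩, rfl⟩
    exact hardyMean_coe_pow_le hp n hr0 hr1

/-- The monomials have norm at least one in `H(b)`. -/
theorem one_le_norm_of_coe_eq_pow {b : hInftyUnitBall} {A : ℂ → ℂ}
    (h : IsPythagoreanPair A (discExt (b : 𝔻 → ℂ))) {n : ℕ} {F : DeBrangesRovnyak b}
    (hF : (F : 𝔻 → ℂ) = fun w : 𝔻 => (w : ℂ) ^ n) : 1 ≤ ‖F‖ := by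
  have key : ∀ r : ℝ, 0 < r → r < 1 → (r ^ n) ^ 2 ≤ ‖F‖ ^ 2 := by
    intro r hr0 hr1
    have h1 := circleNormSq_discExt_le h F hr0 hr1
    have h2 : ∀ z ∈ Metric.sphere (0 : ℂ) |r|, ‖discExt F z‖ ^ 2 = (r ^ n) ^ 2 := fun z hz => by
      rw [mem_sphere_zero_iff_norm, abs_of_pos hr0] at hz
      rw [hF, discExt_coe_pow n (hz.trans_lt hr1), norm_pow, hz]
    rwa [circleNormSq, Real.circleAverage_congr_sphere h2, Real.circleAverage_const] at h1
  have hlim : Tendsto (fun r : ℝ => (r ^ n) ^ 2) (𝓝[<] 1) (𝓝 ((1 ^ n) ^ 2)) :=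
    ((by fun_prop : Continuous fun r : ℝ => (r ^ n) ^ 2).tendsto 1).mono_left nhdsWithin_le_nhds
  have h1 := le_of_tendsto hlim (eventually_mem_Ioo_nhdsLT_one.mono fun r hr => key r hr.1 hr.2)
  rw [one_pow, one_pow] at h1
  exact (one_le_sq_iff₀ (norm_nonneg _)).1 h1

/-- A norm limit of a subsequence of the monomials would vanish, since point evaluations are
continuous and `z^n → 0`; yet it would have norm at least `1`. -/
theorem not_isCompactlyContained {b : hInftyUnitBall} {A : ℂ → ℂ}
    (h : IsPythagoreanPair A (discExt (b : 𝔻 → ℂ))) {p : ℝ} (hp : 0 ≤ p) :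
    ¬ IsCompactlyContained p b := by
  rintro ⟨hsub, hK⟩
  have hex : ∀ n : ℕ, ∃ F : DeBrangesRovnyak b, (F : 𝔻 → ℂ) = fun w : 𝔻 => (w : ℂ) ^ n :=
    fun n => hsub (coe_pow_mem_hardySpace hp n)
  choose F hF using hex
  have hFK : ∀ n, F n ∈ closure {F : DeBrangesRovnyak b |
      (F : 𝔻 → ℂ) ∈ hardySpace p ∧ hardyNorm p F ≤ 1} := fun n => by
    refine subset_closure ⟨?_, ?_⟩
    · rw [hF n]; exact coe_pow_mem_hardySpace hp n
    · rw [hF n]; exact hardyNorm_coe_pow_le hp n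
  obtain ⟨L, -, k, hk, hL⟩ := hK.tendsto_subseq hFK
  have hL0 : L = 0 := by
    refine DFunLike.coe_injective (funext fun z => ?_)
    have h1 : Tendsto (fun n => (F (k n)) z) atTop (𝓝 (L z)) :=
      ((RKHS.continuous_eval (H := DeBrangesRovnyak b) z).tendsto L).comp hL
    have h2 : Tendsto (fun n => (F (k n)) z) atTop (𝓝 0) := by
      have h3 := (tendsto_pow_atTop_nhds_zero_of_norm_lt_one z.norm_lt_one).comp hk.tendsto_atTop
      refine h3.congr fun n => ?_
      exact (congrFun (hF (k n)) z).symm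
    rw [tendsto_nhds_unique h1 h2, RKHS.coe_zero, Pi.zero_apply]
  have h1 := ge_of_tendsto hL.norm
    (Eventually.of_forall fun n => one_le_norm_of_coe_eq_pow h (hF (k n)))
  rw [hL0, norm_zero] at h1
  exact absurd h1 (by norm_num)

theorem mainTheorem1 (b : hInftyUnitBall)
    (hb : (b : 𝔻 → ℂ) ∉ Set.extremePoints ℝ hInftyUnitBall)
    (a : 𝔻 → ℂ) (ha : IsPythagoreanMate a b) (p : ℝ) (hp : 2 < p) :
    (hardySpace p ⊆ dbrFunctions b ↔
      (fun z => (b : 𝔻 → ℂ) z / a z) ∈ hardySpace (2 * p / (p - 2))) ∧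
    ¬ IsCompactlyContained p b :=
  ⟨⟨div_mem_hardySpace ha hp, hardySpace_subset_dbrFunctions ha hp⟩,
    not_isCompactlyContained ha.isPythagoreanPair (by linarith)⟩

end
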